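/- Let $(G,I,O)$ be an open graph: $G=(V,E)$ is a finite simple graph and $I,O\subseteq V$ are the sets of inputs and outputs. Suppose it has a gflow $(g,\prec)$, i.e. $\prec$ is a strict partial order on $V$ and $g:V\setminus O\to 2^{V\setminus I}$ satisfies, for all $u\in V\setminus O$: (g-1) $u\prec v$ for all $v\in g(u)$; (g-2) $u\in \mathrm{Odd}(g(u))$; (g-3) every $v\in\mathrm{Odd}(g(u))$ satisfies $v=u$ or $u\prec v$. Here $\mathrm{Odd}(S)$ is the set of vertices with an odd number of neighbours in $S$. Let $\alpha_v$ $(v\in V\setminus O)$ be real measurement angles and $|\pm_{\theta}\rangle=(|0\rangle\pm e^{i\theta}|1\rangle)/\sqrt2$. *Measurement pattern.* The qubits in $V\setminus I$ are prepared in $|+\rangle$, $\mathrm{CZ}$ is applied along every edge ($E_G=\prod_{uv\in E}\mathrm{CZ}_{u,v}$), and each $v\notin O$ is measured in the basis $|\pm_{\alpha'_v}\rangle$, where the angles are adapted to earlier outcomes $s_u\in\{0,1\}$ ($0$ for $+$, $1$ for $-$): $\alpha'_v=(-1)^{x_v}\alpha_v+z_v\pi$ with $x_v=\sum_{u\notin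 O:\,v\in g(u)}s_u$ and $z_v=\sum_{u\notin O:\,u\ne v,\,v\in \mathrm{Odd}(g(u))}s_u$; finally $X^{x_v}Z^{z_v}$ is applied to each output $v$. In the branch with all outcomes $+$ the implemented map is $\bigotimes_{v\notin O}\langle +_{\alpha_v}|\,E_G\,|+\rangle_{V\setminus I}$. *Acausal circuit.* Fix a path cover of $(G,I,O)$: vertex-disjoint directed paths of $G$ covering $V$, each meeting $I$ at most in its initial vertex and meeting $O$ exactly in its final vertex. The star pattern transformation makes every path a wire; wires starting at an input carry the input state and the other wires start in $|+\rangle$. For every $v\notin O$ it places $J(\alpha_v)=\frac1{\sqrt2}\begin{pmatrix}1&e^{-i\alpha_v}\\1&-e^{-i\alpha_v}\end{pmatrix}$ on the wire of $v$, in the order of the path. For every edge $uv$ of $G$ that is not an edge of a path of the cover it places an acausal gate $\mathrm{ACCZ}_{u!;v!}$ on the positions $u!$ and $v!$, where $v!$ is the position on the wire of $v$ after the $J$-gate of the predecessor of $v$ on its path (if any) and before $J(\alpha_v)$ (if $v\notin O$). The acausal gate is defined by $$\mathrm{ACCZ}_{u!;v!}:=\langle+|_{u'}\langle+|_{v'}\,\mathrm{CZ}_{u!;u'}\,\mathrm{CZ}_{u';v'}\,\mathrm{CZ}_{v';v!}\,|+\rangle_{u'}|+\rangle_{v'}$$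 with two fresh ancillas $u',v'$ for each such edge, prepared in $|+\rangle$ at the start and post-selected on $\langle+|$ at the end. Writing out all acausal gates in this way gives a set of $J$- and $\mathrm{CZ}$-gates; a gate sequence is a linear ordering of these gates that respects all the positions. Then there is an isometry $U:(\mathbb C^2)^{\otimes I}\to(\mathbb C^2)^{\otimes O}$ (unitary if $|I|=|O|$) such that: 1. the measurement pattern implements $U$: the map $\bigotimes_{v\notin O}\langle +_{\alpha_v}|E_G|+\rangle_{V\setminus I}$ is a positive multiple of $U$, and for every outcome string the map implemented by the pattern is a nonzero complex multiple of $U$; 2. the acausal circuit represents the same $U$: at least one gate sequence exists, and there is a constant $r>0$ such that for every gate sequence the post-selected circuit implements the map $rU$. -/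

import Mathlib

open Matrix

noncomputable section

namespace MBQC

/-! ## Qubit registers

A register is a finite type `W` of qubit labels; its computational basis is `W → Fin 2`, and linear
maps between registers are matrices in the computational bases (rows: outputs, columns: inputs). -/

section Registers

variable {W A : Type*} [Fintype W] [DecidableEq W] [Fintype A] [DecidableEq A]

/-- The state `|+⟩ = (|0⟩ + |1⟩) / √2`. -/
def ketPlus : Fin 2 → ℂ := fun _ => 1 / (Real.sqrt 2 : ℂ)

/-- The measurement states `|+_θ⟩` (for `b = 0`) and `|-_θ⟩` (for `b = 1`), that is
`(|0⟩ + (-1)^b e^{iθ} |1⟩) / √2`. -/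
def ketXY (θ : ℝ) (b : Fin 2) : Fin 2 → ℂ :=
  ![1 / (Real.sqrt 2 : ℂ),
    (-1) ^ (b : ℕ) * Complex.exp (Complex.I * (θ : ℂ)) / (Real.sqrt 2 : ℂ)]

/-- Pauli `X`. -/
def pauliX : Matrix (Fin 2) (Fin 2) ℂ := !![0, 1; 1, 0]

/-- Pauli `Z`. -/
def pauliZ : Matrix (Fin 2) (Fin 2) ℂ := !![1, 0; 0, -1]

/-- The gate `J(θ)`. -/
def jMatrix (θ : ℝ) : Matrix (Fin 2) (Fin 2) ℂ :=
  (1 / (Real.sqrt 2 : ℂ)) •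
    !![1, Complex.exp (-Complex.I * (θ : ℂ)); 1, -Complex.exp (-Complex.I * (θ : ℂ))]

/-- The tensor product of one-qubit operators, one for each qubit of the register. -/
def tensor (M : W → Matrix (Fin 2) (Fin 2) ℂ) : Matrix (W → Fin 2) (W → Fin 2) ℂ :=
  fun x y => ∏ w, M w (x w) (y w)

/-- The one-qubit operator `M` acting on qubit `w` of the register. -/
def gateOn (w : W) (M : Matrix (Fin 2) (Fin 2) ℂ) : Matrix (W → Fin 2) (W → Fin 2) ℂ :=
  tensor (Function.update (fun _ => 1) w M)

/-- The diagonal entry at `x` of the `CZ` gate on the (unordered) pair `s` of qubits: `-1` if both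
qubits are in state `1`, and `1` otherwise. -/
def czPhase (s : Sym2 W) (x : W → Fin 2) : ℂ :=
  open Classical in if ∀ w ∈ s, x w = 1 then -1 else 1

/-- The `CZ` gate on an (unordered) pair of qubits. -/
def cz (s : Sym2 W) : Matrix (W → Fin 2) (W → Fin 2) ℂ :=
  Matrix.diagonal (czPhase s)

/-- State preparation: for an injection `ι` of a register `A` into a register `W`, the map that sends
`|φ⟩` to the state of `W` in which the qubits `ι a` are jointly in state `|φ⟩` and every other qubit
`w` is in state `ψ w`. Its adjoint projects each qubit `w` outside the range of `ι` onto `⟨ψ w|`. -/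
def prepare (ι : A → W) (ψ : W → Fin 2 → ℂ) : Matrix (W → Fin 2) (A → Fin 2) ℂ :=
  open Classical in
  fun x a => if x ∘ ι = a then ∏ w with w ∉ Set.range ι, ψ w (x w) else 0

end Registers

section OpenGraphs

variable {V : Type*} [Fintype V] [DecidableEq V]

/-! ## Generalized flow -/

/-- The odd neighbourhood of `S`: the vertices with an odd number of neighbours in `S`. -/
def oddNbhd (G : SimpleGraph V) [DecidableRel G.Adj] (S : Finset V) : Finset V :=
  {v | Odd ({w ∈ S | G.Adj v w} : Finset V).card}

/-- `(g, prec)` is a gflow of the open graph `(G, I, O)`. The map `g` is only relevant on non-output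
vertices; its values at outputs are never used. -/
structure IsGFlow (G : SimpleGraph V) [DecidableRel G.Adj] (I O : Finset V)
    (g : V → Finset V) (prec : V → V → Prop) : Prop where
  irrefl : ∀ u, ¬ prec u u
  trans : ∀ u v w, prec u v → prec v w → prec u w
  image : ∀ u, u ∉ O → ∀ v ∈ g u, v ∉ I
  g1 : ∀ u, u ∉ O → ∀ v ∈ g u, prec u v
  g2 : ∀ u, u ∉ O → u ∈ oddNbhd G (g u)
  g3 : ∀ u, u ∉ O → ∀ v ∈ oddNbhd G (g u), u = v ∨ prec u v

/-! ## Measurement patterns -/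

/-- The graph-state entangler `∏_{uv ∈ E} CZ_{uv}` (a product of commuting diagonal matrices). -/
def entangler (G : SimpleGraph V) [DecidableRel G.Adj] : Matrix (V → Fin 2) (V → Fin 2) ℂ :=
  Matrix.diagonal fun x => ∏ e ∈ G.edgeFinset, czPhase e x

/-- The exponent of the Pauli `X` correction at `v` when the measurement outcomes are `s`: each
non-output vertex `u` with outcome `1` contributes an `X` on all of `g u`. -/
def xCorr (O : Finset V) (g : V → Finset V) (s : V → Fin 2) (v : V) : ℕ :=
  ∑ u with u ∉ O ∧ v ∈ g u, (s u : ℕ)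

/-- The exponent of the Pauli `Z` correction at `v` when the measurement outcomes are `s`: each
non-output vertex `u` with outcome `1` contributes a `Z` on all of `oddNbhd G (g u) \ {u}`. -/
def zCorr (G : SimpleGraph V) [DecidableRel G.Adj] (O : Finset V) (g : V → Finset V)
    (s : V → Fin 2) (v : V) : ℕ :=
  ∑ u with u ∉ O ∧ u ≠ v ∧ v ∈ oddNbhd G (g u), (s u : ℕ)

/-- The linear map implemented by the measurement pattern with angles `α` in the branch where the
outcome at each non-output vertex `v` is `s v` (`0` for `+`, `1` for `-`). Non-input qubits are
prepared in `|+⟩`, the graph is entangled, each non-output vertex `v` is measured at the adapted angle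
`(-1)^(xCorr v) α v + (zCorr v) π`, and the Pauli corrections are applied to the output qubits. For a
gflow the exponents at `v` involve only outcomes of vertices that precede `v`. The values of `α`
and `s` at outputs are never used. -/
def patternBranch (G : SimpleGraph V) [DecidableRel G.Adj] (I O : Finset V) (g : V → Finset V)
    (α : V → ℝ) (s : V → Fin 2) : Matrix (O → Fin 2) (I → Fin 2) ℂ :=
  tensor (fun o : O => pauliX ^ xCorr O g s o * pauliZ ^ zCorr G O g s o)
    * (prepare (fun o : O => (o : V)) fun v =>
        ketXY ((-1) ^ xCorr O g s v * α v + zCorr G O g s v * Real.pi) (s v))ᴴ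
    * entangler G
    * prepare (fun i : I => (i : V)) (fun _ => ketPlus)

/-- The branch of the pattern in which every outcome is `+`, with no adaptation of angles and no
correction: `⊗_{v ∉ O} ⟨+_{α v}| E_G |+⟩_{Iᶜ}`. -/
def patternMap (G : SimpleGraph V) [DecidableRel G.Adj] (I O : Finset V) (α : V → ℝ) :
    Matrix (O → Fin 2) (I → Fin 2) ℂ :=
  (prepare (fun o : O => (o : V)) fun v => ketXY (α v) 0)ᴴ
    * entangler G
    * prepare (fun i : I => (i : V)) (fun _ => ketPlus)

/-! ## Path covers -/

/-- A path cover of the open graph `(G, I, O)`: vertex-disjoint directed paths (lists of vertices, in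
the direction of the path, possibly with one vertex only) that cover all vertices; a path meets `I`
at most at its initial vertex, and it meets `O` exactly at its final vertex. -/
structure PathCover (G : SimpleGraph V) (I O : Finset V) where
  paths : Finset (List V)
  ne_nil : ∀ p ∈ paths, p ≠ []
  nodup : ∀ p ∈ paths, p.Nodup
  chain : ∀ p ∈ paths, p.IsChain G.Adj
  cover : ∀ v : V, ∃! p, p ∈ paths ∧ v ∈ p
  input : ∀ p ∈ paths, ∀ v ∈ p, v ∈ I → p.head? = some v
  output : ∀ p ∈ paths, ∀ v ∈ p, (v ∈ O ↔ p.getLast? = some v)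

variable {G : SimpleGraph V} {I O : Finset V}

/-- `u → v` is a step of one of the paths. -/
def PathCover.Step (P : PathCover G I O) (u v : V) : Prop :=
  ∃ p ∈ P.paths, [u, v] <:+: p

/-- The path that contains `v`. -/
def PathCover.pathOf (P : PathCover G I O) (v : V) : {p // p ∈ P.paths} :=
  ⟨(P.cover v).choose, (P.cover v).choose_spec.1.1⟩

/-- The graph formed by the edges of `G` that do not belong to a path of the cover. -/
def PathCover.offGraph (P : PathCover G I O) : SimpleGraph V where
  Adj u v := G.Adj u v ∧ ¬ P.Step u v ∧ ¬ P.Step v u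
  symm := ⟨fun _ _ h => ⟨h.1.symm, h.2.2, h.2.1⟩⟩
  loopless := ⟨fun _ h => h.1.ne rfl⟩

instance PathCover.offGraph_decidable (P : PathCover G I O) : DecidableRel P.offGraph.Adj :=
  fun _ _ => Classical.propDecidable _

/-! ## Acausal circuits

The star pattern transformation turns each path into a wire, places `J(α v)` for every non-output
vertex `v` on the wire of `v`, and places an acausal `CZ` gate on the positions `u!` and `v!` for every
non-path edge `uv`. Here `v!` is the position on the wire of `v` that follows `J` of the predecessor of
`v` on its path (if any) and comes before `J(α v)` (if `v` is not an output).

The acausal `CZ` on `u!` and `v!` is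
`⟨+|_{u'} ⟨+|_{v'} CZ_{u!,u'} CZ_{u',v'} CZ_{v',v!} |+⟩_{u'} |+⟩_{v'}`
with two fresh ancillas `u'` and `v'`. The ancilla `u'` belonging to the edge `uv` is labelled by the
dart `(u, v)`, and `v'` by the opposite dart `(v, u)`. -/

/-- The qubits of the circuit: the wires, and two ancillas for every acausal `CZ` gate. -/
abbrev PathCover.Qubit (P : PathCover G I O) : Type _ :=
  {p // p ∈ P.paths} ⊕ P.offGraph.Dart

/-- The gate occurrences of the circuit after every acausal `CZ` is written out by its definition. -/
inductive PathCover.Gate (P : PathCover G I O) where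
  /-- The gate `J(α v)` of a non-output vertex `v`. -/
  | j (v : V) (hv : v ∉ O)
  /-- For the dart `(u, v)`: the gate `CZ_{u!,u'}` between position `u!` and the ancilla `u'`. -/
  | link (d : P.offGraph.Dart)
  /-- For a pair of opposite darts: the gate `CZ_{u',v'}` between the two ancillas. -/
  | mid (t : Sym2 P.offGraph.Dart) (ht : ∃ d, t = s(d, d.symm))

/-- The operator of a gate on all qubits of the circuit. -/
def PathCover.Gate.op {P : PathCover G I O} (α : V → ℝ) :
    P.Gate → Matrix (P.Qubit → Fin 2) (P.Qubit → Fin 2) ℂ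
  | .j v _ => gateOn (Sum.inl (P.pathOf v)) (jMatrix (α v))
  | .link d => cz s(Sum.inl (P.pathOf d.fst), Sum.inr d)
  | .mid t _ => cz (t.map Sum.inr)

/-- The order constraints imposed by the positions: along a path, the `J` gates act in the order of
the vertices; a gate at position `v!` acts after `J` of the predecessor of `v` and before `J(α v)`. -/
def PathCover.Gate.Before {P : PathCover G I O} : P.Gate → P.Gate → Prop
  | .j u _, .j v _ => P.Step u v
  | .j u _, .link d => P.Step u d.fst
  | .link d, .j v _ => d.fst = v
  | _, _ => False

/-- A gate sequence (in order of time) of the acausal circuit: every gate occurs exactly once, and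
the order constraints are respected. -/
structure PathCover.IsGateSequence (P : PathCover G I O) (L : List P.Gate) : Prop where
  nodup : L.Nodup
  complete : ∀ a : P.Gate, a ∈ L
  order : L.Pairwise fun a b => ¬ b.Before a

/-- The linear map represented by the acausal circuit, for a gate sequence `L`: the wires of the
inputs carry the input state and all other qubits (the wires that do not start at an input, and the
ancillas) are prepared in `|+⟩`; the gates act in the order of `L`; finally the ancillas (the qubits
that are not the wire of an output) are post-selected on `⟨+|`. -/
def PathCover.circuitMap (P : PathCover G I O) (α : V → ℝ) (L : List P.Gate) :
    Matrix (O → Fin 2) (I → Fin 2) ℂ :=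
  (prepare (fun o : O => (Sum.inl (P.pathOf o) : P.Qubit)) (fun _ => ketPlus))ᴴ
    * (L.map (PathCover.Gate.op α)).reverse.prod
    * prepare (fun i : I => (Sum.inl (P.pathOf i) : P.Qubit)) (fun _ => ketPlus)

end OpenGraphs

end MBQC

end

noncomputable section

namespace MBQC

set_option linter.unusedSectionVars false

/-! Pattern and circuit are both written as path sums over bit assignments `x : V → Fin 2`. In the
all-`+` branch the summand is the product of the measurement bras and the signs of all edges, with
`x` fixed on `I` and `O`.

For the other branches, substitute `x = y + k`, where `k` is the parity of the X corrections. By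
bilinearity of the CZ exponent this costs a constant phase and a Z on `v` for every neighbour `w`
with `k w = 1`. The gflow conditions make the parity of these Z's equal to `zCorr`, plus the outcome
`s v` if `v` is measured (`neg_one_pow_sum_xCorr`). The adapted bras absorb X and Z up to a scalar
(`exists_star_ketXY_add`), and the output corrections cancel the rest. Every branch is therefore a
nonzero multiple of the same map `M` (`exists_patternBranch_eq_smul`).

The adaptive measurement is still an orthonormal basis: two outcome strings first differ at a
`prec`-minimal vertex, where the angles agree (`branchBasis_isometry`). Hence the Gram matrices of
the branches add up to `1`. Each is a positive multiple of `Mᴴ * M`, so `M` is a positive multiple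
of an isometry.

For the circuit, the path sum after the gates of a past-closed set depends on that set only
(`op_mul_amplitude`), so all gate sequences give the same map. Summing out the two ancillas of an
acausal gate leaves twice a CZ sign (`sum_czSign_mul`), and a `J` gate is a bra times the CZ sign of
a path edge (`jMatrix_apply`). Together these signs give the entangler, and the path sum of `M`
reappears up to a positive factor. -/

/-- The diagonal entry of `CZ` as a function of the two bits. -/
def czSign (a b : Fin 2) : ℂ := if a = 1 ∧ b = 1 then -1 else 1

/-- The exponent of the sign is bilinear over the two-element field; the bracketed cross terms are
the Z's created by moving X through CZ. -/
theorem czSign_add_add (a b k l : Fin 2) :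
    czSign (a + k) (b + l) = czSign a b * czSign k l * (czSign a l * czSign b k) := by
  fin_cases a <;> fin_cases b <;> fin_cases k <;> fin_cases l <;> simp [czSign]

theorem czSign_eq_pow (a b : Fin 2) : czSign a b = (-1) ^ ((a : ℕ) * (b : ℕ)) := by
  fin_cases a <;> fin_cases b <;> simp [czSign]

/-- The sum over `r.1` vanishes unless `r.2 = p`, where it is `2`; what remains is the sign of `q`
against `p`. This is the acausal gate acting as CZ. -/
theorem sum_czSign_mul (p q : Fin 2) :
    ∑ r : Fin 2 × Fin 2, czSign p r.1 * czSign q r.2 * czSign r.1 r.2 = 2 * czSign p q := by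
  rw [Fintype.sum_prod_type]
  fin_cases p <;> fin_cases q <;> simp [czSign] <;> norm_num

/-! ### Matrix entries of gates and preparations -/

section Registers

variable {W A B : Type*} [Fintype W] [Fintype A] [Fintype B]

theorem tensor_conjTranspose (M : W → Matrix (Fin 2) (Fin 2) ℂ) :
    (tensor M)ᴴ = tensor fun w => (M w)ᴴ := by
  ext x y
  simp [conjTranspose_apply, tensor]

theorem tensor_one : tensor (fun _ : W => (1 : Matrix (Fin 2) (Fin 2) ℂ)) = 1 := by
  ext x y
  simp only [tensor, one_apply]
  split_ifs with h
  · simp [h]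
  · obtain ⟨w, hw⟩ := Function.ne_iff.1 h
    exact Finset.prod_eq_zero (Finset.mem_univ w) (if_neg hw)

variable [DecidableEq W]

theorem prepare_apply (ι : A → W) (ψ : W → Fin 2 → ℂ) (x : W → Fin 2) (a : A → Fin 2) :
    prepare ι ψ x a = open Classical in
      if x ∘ ι = a then ∏ w with w ∉ Set.range ι, ψ w (x w) else 0 := rfl

theorem czPhase_mk (u v : W) (x : W → Fin 2) : czPhase s(u, v) x = czSign (x u) (x v) := by
  simp [czPhase, czSign]

theorem czPhase_ne_zero (s : Sym2 W) (x : W → Fin 2) : czPhase s x ≠ 0 := by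
  unfold czPhase; split_ifs <;> simp

theorem czPhase_star_mul_self (s : Sym2 W) (x : W → Fin 2) :
    star (czPhase s x) * czPhase s x = 1 := by
  unfold czPhase; split_ifs <;> simp

theorem gateOn_apply (w : W) (M : Matrix (Fin 2) (Fin 2) ℂ) (x y : W → Fin 2) :
    gateOn w M x y = if ∀ v, v ≠ w → x v = y v then M (x w) (y w) else 0 := by
  unfold gateOn tensor
  rw [← Finset.mul_prod_erase _ _ (Finset.mem_univ w)]
  simp only [Function.update_self]
  split_ifs with h
  · rw [Finset.prod_eq_one, mul_one]
    intro v hv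
    have hv' := Finset.ne_of_mem_erase hv
    rw [Function.update_of_ne hv', h v hv', one_apply_eq]
  · push Not at h
    obtain ⟨v, hv, hne⟩ := h
    rw [Finset.prod_eq_zero (Finset.mem_erase.2 ⟨hv, Finset.mem_univ v⟩), mul_zero]
    rw [Function.update_of_ne hv, one_apply_ne hne]

/-- Only assignments that agree with `x` off `w` contribute, so the matrix product collapses to a
sum over one bit. -/
theorem gateOn_mul_apply {C : Type*} (w : W) (M : Matrix (Fin 2) (Fin 2) ℂ) (N : Matrix (W → Fin 2) C ℂ)
    (x : W → Fin 2) (b : C) :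
    (gateOn w M * N) x b = ∑ t, M (x w) t * N (Function.update x w t) b := by
  simp only [mul_apply, gateOn_apply, ite_mul, zero_mul]
  rw [← Finset.sum_filter]
  refine Finset.sum_bij' (fun y _ => y w) (fun t _ => Function.update x w t) ?_ ?_ ?_ ?_ ?_
  · simp
  · intro t _
    simp only [Finset.mem_filter, Finset.mem_univ, true_and]
    intro v hv
    rw [Function.update_of_ne hv]
  · intro y hy
    simp only [Finset.mem_filter, Finset.mem_univ, true_and] at hy
    ext v
    by_cases hv : v = w
    · subst hv; simp
    · rw [Function.update_of_ne hv, hy v hv]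
  · simp
  · intro y hy
    simp only [Finset.mem_filter, Finset.mem_univ, true_and] at hy
    congr 2
    ext v
    by_cases hv : v = w
    · subst hv; simp
    · rw [Function.update_of_ne hv, hy v hv]

theorem tensor_mul (M N : W → Matrix (Fin 2) (Fin 2) ℂ) :
    tensor M * tensor N = tensor fun w => M w * N w := by
  ext x y
  simp only [mul_apply, tensor, ← Finset.prod_mul_distrib, Finset.prod_univ_sum,
    Fintype.piFinset_univ]

/-- The matrix entries of a preparation from a subset of the register. -/
theorem prepare_coe_apply (S : Finset W) (ψ : W → Fin 2 → ℂ) (x : W → Fin 2) (a : S → Fin 2) :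
    prepare (fun i : S => (i : W)) ψ x a =
      if (fun i : S => x i) = a then ∏ w with w ∉ S, ψ w (x w) else 0 := by
  rw [prepare_apply]
  simp [Function.comp_def]

/-- The same entries as a product over the whole register. -/
theorem prepare_coe_apply_eq_prod (S : Finset W) (ψ : W → Fin 2 → ℂ) (x : W → Fin 2)
    (a : S → Fin 2) :
    prepare (fun i : S => (i : W)) ψ x a =
      ∏ w, if h : w ∈ S then (if x w = a ⟨w, h⟩ then 1 else 0) else ψ w (x w) := by
  rw [prepare_coe_apply]
  split_ifs with h
  · rw [Finset.prod_filter]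
    refine Finset.prod_congr rfl fun w _ => ?_
    by_cases hw : w ∈ S
    · simp [hw, ← h]
    · simp [hw]
  · obtain ⟨i, hi⟩ := Function.ne_iff.1 h
    symm
    apply Finset.prod_eq_zero (Finset.mem_univ (i : W))
    simp [hi]

theorem prepare_coe_isometry (S : Finset W) (ψ : W → Fin 2 → ℂ)
    (hψ : ∀ w, ∑ t, star (ψ w t) * ψ w t = 1) :
    (prepare (fun i : S => (i : W)) ψ)ᴴ * prepare (fun i : S => (i : W)) ψ = 1 := by
  ext a b
  simp only [mul_apply, conjTranspose_apply, prepare_coe_apply_eq_prod, star_prod,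
    ← Finset.prod_mul_distrib]
  have := Finset.prod_univ_sum (fun _ : W => (Finset.univ : Finset (Fin 2)))
    (fun w t => star (if h : w ∈ S then (if t = a ⟨w, h⟩ then (1 : ℂ) else 0) else ψ w t) *
      (if h : w ∈ S then (if t = b ⟨w, h⟩ then 1 else 0) else ψ w t))
  rw [Fintype.piFinset_univ] at this
  rw [← this, one_apply]
  split_ifs with hab
  · subst hab
    refine Finset.prod_eq_one fun w _ => ?_
    by_cases hw : w ∈ S
    · simp [hw]
    · simpa [hw] using hψ w
  · obtain ⟨i, hi⟩ := Function.ne_iff.1 hab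
    apply Finset.prod_eq_zero (Finset.mem_univ (i : W))
    simp [Ne.symm hi]

theorem ketPlus_normalized : ∑ t, star (ketPlus t) * ketPlus t = 1 := by
  have h : (Real.sqrt 2 : ℂ) * (Real.sqrt 2 : ℂ) = 2 := by
    rw [← Complex.ofReal_mul, Real.mul_self_sqrt (by norm_num)]; norm_num
  have h0 : (Real.sqrt 2 : ℂ) ≠ 0 := by
    intro h1; rw [h1] at h; norm_num at h
  simp [ketPlus]
  field_simp
  rw [pow_two, h]

theorem ketXY_orthonormal (θ : ℝ) (b c : Fin 2) :
    ∑ t, star (ketXY θ b t) * ketXY θ c t = if b = c then 1 else 0 := by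
  have h : (Real.sqrt 2 : ℂ) * (Real.sqrt 2 : ℂ) = 2 := by
    rw [← Complex.ofReal_mul, Real.mul_self_sqrt (by norm_num)]; norm_num
  have h0 : (Real.sqrt 2 : ℂ) ≠ 0 := by
    intro h1; rw [h1] at h; norm_num at h
  have he : Complex.exp (-(Complex.I * θ)) * Complex.exp (Complex.I * θ) = 1 := by
    rw [← Complex.exp_add]; simp
  have hc : (starRingEnd ℂ) (Complex.exp (Complex.I * θ)) = Complex.exp (-(Complex.I * θ)) := by
    rw [← Complex.exp_conj]; simp
  rw [Fin.sum_univ_two]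
  have e0 : ∀ b, ketXY θ b 0 = 1 / (Real.sqrt 2 : ℂ) := fun b => rfl
  have e1 : ∀ b, ketXY θ b 1 =
    (-1) ^ (b : ℕ) * Complex.exp (Complex.I * (θ : ℂ)) / (Real.sqrt 2 : ℂ) := fun b => rfl
  rw [e0, e0, e1, e1]
  simp only [RCLike.star_def, map_div₀, map_mul, map_one, map_pow, map_neg, Complex.conj_ofReal, hc]
  have key : (1 : ℂ) / (Real.sqrt 2 : ℂ) * (1 / (Real.sqrt 2 : ℂ)) +
      (-1) ^ (b : ℕ) * Complex.exp (-(Complex.I * θ)) / (Real.sqrt 2 : ℂ) *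
        ((-1) ^ (c : ℕ) * Complex.exp (Complex.I * θ) / (Real.sqrt 2 : ℂ)) =
      (1 + (-1) ^ (b : ℕ) * (-1) ^ (c : ℕ)) / 2 := by
    rw [← h]
    field_simp
    linear_combination ((-1) ^ (b : ℕ) * (-1) ^ (c : ℕ)) * he
  rw [key]
  fin_cases b <;> fin_cases c <;> simp

/-- Entries of a diagonal operator between a preparation and a projection, as a path sum. -/
theorem project_diagonal_prepare_apply (ι : A → W) (κ : B → W) (ψ φ : W → Fin 2 → ℂ)
    (D : (W → Fin 2) → ℂ) (b : A → Fin 2) (a : B → Fin 2) :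
    ((prepare ι ψ)ᴴ * diagonal D * prepare κ φ) b a =
      ∑ x, star (prepare ι ψ x b) * D x * prepare κ φ x a := by
  rw [mul_apply]
  simp only [mul_diagonal, conjTranspose_apply]

end Registers

/-! ### Pauli operators and adapted measurement angles -/

section Bits

theorem neg_one_pow_mul_ofNat (a n : ℕ) :
    (-1 : ℂ) ^ (a * ((Fin.ofNat 2 n : Fin 2) : ℕ)) = (-1) ^ (a * n) := by
  have h : ((Fin.ofNat 2 n : Fin 2) : ℕ) = n % 2 := rfl
  rw [h, mul_comm, pow_mul, mul_comm a n, pow_mul, ← neg_one_pow_eq_pow_mod_two]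

theorem fin_two_add_self (k : Fin 2) : k + k = 0 := by
  fin_cases k <;> rfl

theorem fin_two_ofNat_even {m : ℕ} (h : Even m) : (Fin.ofNat 2 m : Fin 2) = 0 := by
  ext; simpa using Nat.even_iff.1 h

theorem fin_two_ofNat_odd {m : ℕ} (h : Odd m) : (Fin.ofNat 2 m : Fin 2) = 1 := by
  ext; simpa using Nat.odd_iff.1 h

theorem pauliX_pow_mul_pauliZ_pow_apply (m n : ℕ) (p q : Fin 2) :
    (pauliX ^ m * pauliZ ^ n) p q =
      if p = q + Fin.ofNat 2 m then (-1) ^ ((q : ℕ) * n) else 0 := by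
  have hX : pauliX * pauliX = 1 := by
    ext i j; fin_cases i <;> fin_cases j <;> simp [pauliX]
  have hZ : pauliZ ^ n = !![1, 0; 0, (-1) ^ n] := by
    induction n with
    | zero => ext i j; fin_cases i <;> fin_cases j <;> simp
    | succ n ih =>
      rw [pow_succ, ih]
      ext i j; fin_cases i <;> fin_cases j <;> simp [pauliZ, pow_succ]
  rw [hZ]
  rcases Nat.even_or_odd m with h | h
  · rw [fin_two_ofNat_even h]
    obtain ⟨k, rfl⟩ := h
    rw [← two_mul, pow_mul, pow_two, hX, one_pow, one_mul]
    fin_cases p <;> fin_cases q <;> simp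
  · rw [fin_two_ofNat_odd h]
    obtain ⟨k, rfl⟩ := h
    rw [pow_add, pow_mul, pow_two, hX, one_pow, one_mul, pow_one, pauliX]
    fin_cases p <;> fin_cases q <;> simp

theorem pauli_unitary (m n : ℕ) :
    (pauliX ^ m * pauliZ ^ n)ᴴ * (pauliX ^ m * pauliZ ^ n) = 1 := by
  have hX : pauliX ∈ unitary (Matrix (Fin 2) (Fin 2) ℂ) := by
    rw [Unitary.mem_iff]
    constructor <;>
    · rw [star_eq_conjTranspose]
      ext i j; fin_cases i <;> fin_cases j <;> simp [pauliX, mul_apply]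
  have hZ : pauliZ ∈ unitary (Matrix (Fin 2) (Fin 2) ℂ) := by
    rw [Unitary.mem_iff]
    constructor <;>
    · rw [star_eq_conjTranspose]
      ext i j; fin_cases i <;> fin_cases j <;> simp [pauliZ, mul_apply]
  exact Unitary.star_mul_self_of_mem (mul_mem (pow_mem hX m) (pow_mem hZ n))

/-- A measurement at an adapted angle absorbs the Pauli operators `X ^ m` and `Z ^ (n + b)`. -/
theorem exists_star_ketXY_add (α : ℝ) (m n : ℕ) (b : Fin 2) :
    ∃ c : ℂ, c ≠ 0 ∧ ∀ y : Fin 2,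
      star (ketXY ((-1) ^ m * α + n * Real.pi) b (y + Fin.ofNat 2 m)) *
        (-1) ^ ((y : ℕ) * (n + b)) = c * star (ketXY α 0 y) := by
  have e0 : ∀ θ b, ketXY θ b 0 = 1 / (Real.sqrt 2 : ℂ) := fun _ _ => rfl
  have e1 : ∀ θ b, ketXY θ b 1 =
    (-1) ^ (b : ℕ) * Complex.exp (Complex.I * (θ : ℂ)) / (Real.sqrt 2 : ℂ) := fun _ _ => rfl
  have hexp : ∀ β : ℝ, Complex.exp (Complex.I * ((β + n * Real.pi : ℝ) : ℂ)) =
      Complex.exp (Complex.I * β) * (-1) ^ n := by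
    intro β
    rw [← Complex.exp_pi_mul_I, ← Complex.exp_nat_mul, ← Complex.exp_add]
    push_cast
    ring_nf
  have hs : ∀ k : ℕ, ((-1 : ℂ) ^ k) * (-1) ^ k = 1 := by
    intro k; rw [← mul_pow]; simp
  have hc : ∀ β : ℝ, (starRingEnd ℂ) (Complex.exp (Complex.I * β)) =
      Complex.exp (-(Complex.I * β)) := by
    intro β; rw [← Complex.exp_conj]; simp
  rcases Nat.even_or_odd m with h | h
  · refine ⟨1, one_ne_zero, fun y => ?_⟩
    rw [fin_two_ofNat_even h, h.neg_one_pow, add_zero, one_mul, one_mul]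
    fin_cases y
    · simp [e0]
    · simp only [Fin.mk_one, e1, hexp, RCLike.star_def, map_div₀, map_mul, map_pow, map_neg, map_one,
        one_mul, Fin.val_zero, pow_zero, pow_add]
      linear_combination ((starRingEnd ℂ) (Complex.exp (Complex.I * α)) /
        (starRingEnd ℂ) (Real.sqrt 2 : ℂ)) * ((-1) ^ (b : ℕ) * (-1) ^ (b : ℕ) * hs n + hs b)
  -- The flip swaps the amplitudes of a bra at angle `-α + nπ`. The entry `y = 0` dictates this
  -- scalar, and its phase turns the other entry into that of the bra at `α`.
  · refine ⟨(-1) ^ (b : ℕ) * (-1) ^ n * Complex.exp (Complex.I * α), ?_, fun y => ?_⟩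
    · simp
    rw [fin_two_ofNat_odd h, h.neg_one_pow, neg_one_mul]
    have he : Complex.exp (Complex.I * α) * Complex.exp (-(Complex.I * α)) = 1 := by
      rw [← Complex.exp_add]; simp
    fin_cases y
    · simp only [Fin.zero_eta, zero_add, e1, e0, hexp, RCLike.star_def, map_div₀, map_mul, map_pow,
        map_neg, map_one, zero_mul, pow_zero, mul_one, hc, Complex.ofReal_neg, mul_neg,
        Complex.exp_neg, map_inv₀, inv_inv]
      ring
    · have h11 : (1 : Fin 2) + 1 = 0 := rfl
      simp only [Fin.mk_one, h11, e1, e0, RCLike.star_def, map_div₀,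
        map_one, one_mul, Fin.val_zero, pow_zero, pow_add, hc]
      linear_combination (-(1 / (starRingEnd ℂ) (Real.sqrt 2 : ℂ)) * ((-1) ^ (b : ℕ) * (-1) ^ n)) * he

end Bits

/-! ### Parity of corrections across the entangler -/

section Graphs

variable {V : Type*} [Fintype V] [DecidableEq V] (G : SimpleGraph V) [DecidableRel G.Adj]

/-- Each edge carries exactly two darts, opposite to each other. -/
theorem prod_darts_eq_prod_edgeFinset (f : G.Dart → ℂ) (F : Sym2 V → ℂ)
    (h : ∀ d : G.Dart, f d * f d.symm = F d.edge) :
    ∏ d, f d = ∏ e ∈ G.edgeFinset, F e := by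
  rw [← Finset.prod_fiberwise_of_maps_to (t := G.edgeFinset) (g := SimpleGraph.Dart.edge)
    (fun d _ => by simp)]
  refine Finset.prod_congr rfl fun e he => ?_
  obtain ⟨u, v⟩ := e
  have huv : G.Adj u v := by simpa using he
  let d : G.Dart := ⟨(u, v), huv⟩
  have h1 := d.edge_fiber
  have h2 : d.edge = Sym2.mk u v := rfl
  rw [h2] at h1
  rw [h1, Finset.prod_pair d.symm_ne.symm, h d, h2]

theorem prod_darts_eq_prod_prod_adj (f : V → V → ℂ) :
    ∏ d : G.Dart, f d.fst d.snd = ∏ v, ∏ w with G.Adj v w, f v w := by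
  rw [← Finset.prod_fiberwise Finset.univ (fun d : G.Dart => d.fst)]
  refine Finset.prod_congr rfl fun v _ => ?_
  refine Finset.prod_bij (fun d _ => d.snd) ?_ ?_ ?_ ?_
  · intro d hd
    obtain rfl : d.fst = v := by simpa using hd
    simp
  · intro d hd d' hd' h
    simp only [Finset.mem_filter, Finset.mem_univ, true_and] at hd hd'
    exact SimpleGraph.Dart.ext _ _ (Prod.ext (hd.trans hd'.symm) h)
  · intro w hw
    exact ⟨⟨(v, w), by simpa using hw⟩, by simp, rfl⟩
  · intro d hd
    obtain rfl : d.fst = v := by simpa using hd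
    rfl

/-- The diagonal of the entangler. -/
def entanglerPhase (x : V → Fin 2) : ℂ := ∏ e ∈ G.edgeFinset, czPhase e x

theorem entanglerPhase_ne_zero (x : V → Fin 2) : entanglerPhase G x ≠ 0 :=
  Finset.prod_ne_zero_iff.2 fun e _ => czPhase_ne_zero e x

/-- Commuting `X` operators on `k` through the entangler produces `Z` operators on neighbours. -/
theorem entanglerPhase_add (y k : V → Fin 2) :
    entanglerPhase G (y + k) = entanglerPhase G y * entanglerPhase G k *
      ∏ v, ∏ w with G.Adj v w, czSign (y v) (k w) := by
  -- The two cross signs of an edge multiply to a quotient of CZ phases, which depends on the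
  -- unordered edge only.
  rw [← prod_darts_eq_prod_prod_adj G fun v w => czSign (y v) (k w),
    prod_darts_eq_prod_edgeFinset G _
      (fun e => czPhase e (y + k) / (czPhase e y * czPhase e k))]
  · unfold entanglerPhase
    rw [← Finset.prod_mul_distrib, ← Finset.prod_mul_distrib]
    refine Finset.prod_congr rfl fun e _ => ?_
    rw [mul_div_cancel₀]
    exact mul_ne_zero (czPhase_ne_zero _ _) (czPhase_ne_zero _ _)
  · intro d
    have he : d.edge = s(d.fst, d.snd) := rfl
    rw [eq_div_iff (mul_ne_zero (czPhase_ne_zero _ _) (czPhase_ne_zero _ _)), he]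
    simp only [czPhase_mk, Pi.add_apply, czSign_add_add]
    change _ * czSign (y d.snd) (k d.fst) * _ = _
    ring

/-- Exchange the sums over `u` and `w`: the outcome `s u` is counted once for each neighbour of `v`
in `g u`, hence survives modulo 2 exactly when `v` is in the odd neighbourhood of `g u`. For
measured `v`, condition (g-2) supplies the term `u = v`, which `zCorr` leaves out. -/
theorem neg_one_pow_sum_xCorr {I O : Finset V} {g : V → Finset V} {prec : V → V → Prop}
    (hg : IsGFlow G I O g prec) (s : V → Fin 2) (v : V) :
    (-1 : ℂ) ^ (∑ w with G.Adj v w, xCorr O g s w) =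
      (-1) ^ (zCorr G O g s v + if v ∈ O then 0 else (s v : ℕ)) := by
  have h1 : zCorr G O g s v + (if v ∈ O then 0 else (s v : ℕ)) =
      ∑ u with u ∉ O ∧ v ∈ oddNbhd G (g u), (s u : ℕ) := by
    rw [← Finset.sum_filter_not_add_sum_filter _ (fun u => u = v)]
    congr 1
    · unfold zCorr
      rw [Finset.filter_filter]
      refine Finset.sum_congr (Finset.filter_congr fun u _ => ?_) fun _ _ => rfl
      tauto
    · rw [Finset.filter_filter]
      split_ifs with hv
      · symm
        apply Finset.sum_eq_zero
        simp only [Finset.mem_filter, Finset.mem_univ, true_and]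
        rintro u ⟨⟨hu, -⟩, rfl⟩
        exact absurd hv hu
      · have : ({u | (u ∉ O ∧ v ∈ oddNbhd G (g u)) ∧ u = v} : Finset V) = {v} := by
          ext u
          simp only [Finset.mem_filter, Finset.mem_univ, true_and, Finset.mem_singleton]
          refine ⟨fun h => h.2, ?_⟩
          rintro rfl
          exact ⟨⟨hv, hg.g2 u hv⟩, rfl⟩
        rw [this, Finset.sum_singleton]
  rw [h1]
  unfold xCorr
  simp only [Finset.sum_filter]
  have h2 : ∀ w, (if G.Adj v w then ∑ u, (if u ∉ O ∧ w ∈ g u then (s u : ℕ) else 0) else 0) =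
      ∑ u, if u ∉ O ∧ (w ∈ g u ∧ G.Adj v w) then (s u : ℕ) else 0 := by
    intro w
    split_ifs with h <;> simp [h]
  simp only [h2]
  rw [Finset.sum_comm, ← Finset.prod_pow_eq_pow_sum, ← Finset.prod_pow_eq_pow_sum]
  refine Finset.prod_congr rfl fun u _ => ?_
  by_cases hu : u ∈ O
  · simp [hu]
  · simp only [hu, not_false_eq_true, true_and]
    rw [← Finset.sum_filter, Finset.sum_const, smul_eq_mul, pow_mul]
    have h3 : ({w | w ∈ g u ∧ G.Adj v w} : Finset V) = {w ∈ g u | G.Adj v w} := by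
      ext; simp
    rw [h3]
    have h4 : v ∈ oddNbhd G (g u) ↔ Odd ({w ∈ g u | G.Adj v w} : Finset V).card := by
      simp [oddNbhd]
    split_ifs with h
    · rw [(h4.1 h).neg_one_pow]
    · rw [(Nat.not_odd_iff_even.1 (mt h4.2 h)).neg_one_pow, one_pow, pow_zero]

end Graphs

/-! ### All branches are proportional -/

section Patterns

variable {V : Type*} [Fintype V] [DecidableEq V] (G : SimpleGraph V) [DecidableRel G.Adj]
  {I O : Finset V} {g : V → Finset V} {prec : V → V → Prop}

/-- The path sum of a branch. -/
theorem patternBranch_apply (α : V → ℝ) (s : V → Fin 2) (o : O → Fin 2) (a : I → Fin 2) :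
    patternBranch G I O g α s o a =
      ∑ x : V → Fin 2, (∏ v : O, (pauliX ^ xCorr O g s v * pauliZ ^ zCorr G O g s v) (o v) (x v)) *
        (∏ v with v ∉ O, star (ketXY ((-1) ^ xCorr O g s v * α v + zCorr G O g s v * Real.pi)
          (s v) (x v))) * entanglerPhase G x *
        prepare (fun i : I => (i : V)) (fun _ => ketPlus) x a := by
  unfold patternBranch entangler
  rw [Matrix.mul_assoc, Matrix.mul_assoc, ← Matrix.mul_assoc _ (diagonal _), mul_apply]
  simp only [project_diagonal_prepare_apply, Finset.mul_sum]
  rw [Finset.sum_comm]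
  refine Finset.sum_congr rfl fun x _ => ?_
  rw [Finset.sum_eq_single (fun v : O => x v)]
  · rw [prepare_coe_apply, if_pos rfl, star_prod]
    simp only [tensor, entanglerPhase]
    ring
  · intro o' _ ho'
    rw [prepare_coe_apply, if_neg ho'.symm]
    simp
  · simp

theorem patternMap_apply (α : V → ℝ) (o : O → Fin 2) (a : I → Fin 2) :
    patternMap G I O α o a =
      ∑ x : V → Fin 2, if (fun v : O => x v) = o then
        (∏ v with v ∉ O, star (ketXY (α v) 0 (x v))) * entanglerPhase G x *
          prepare (fun i : I => (i : V)) (fun _ => ketPlus) x a else 0 := by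
  unfold patternMap entangler
  rw [project_diagonal_prepare_apply]
  refine Finset.sum_congr rfl fun x _ => ?_
  rw [prepare_coe_apply O]
  split_ifs
  · rw [star_prod]; rfl
  · simp

/-- Both amplitudes of `|+⟩` are equal, so flipping non-input bits changes nothing. -/
theorem prepare_ketPlus_add (y k : V → Fin 2) (a : I → Fin 2) (hk : ∀ v ∈ I, k v = 0) :
    prepare (fun i : I => (i : V)) (fun _ => ketPlus) (y + k) a =
      prepare (fun i : I => (i : V)) (fun _ => ketPlus) y a := by
  have h : (fun i : I => (y + k) i) = fun i : I => y i := by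
    funext i
    simp [hk i i.2]
  rw [prepare_coe_apply, prepare_coe_apply, h]
  rfl

theorem xCorr_eq_zero (hg : IsGFlow G I O g prec) (s : V → Fin 2) {v : V} (hv : v ∈ I) :
    xCorr O g s v = 0 := by
  unfold xCorr
  apply Finset.sum_eq_zero
  simp only [Finset.mem_filter, Finset.mem_univ, true_and]
  rintro u ⟨hu, hvu⟩
  exact absurd hv (hg.image u hu v hvu)

/-- Every branch of the pattern agrees with the all-`+` branch up to a nonzero scalar. -/
theorem exists_patternBranch_eq_smul (hg : IsGFlow G I O g prec) (α : V → ℝ) (s : V → Fin 2) :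
    ∃ c : ℂ, c ≠ 0 ∧ patternBranch G I O g α s = c • patternMap G I O α := by
  choose c hc0 hc using fun v =>
    exists_star_ketXY_add (α v) (xCorr O g s v) (zCorr G O g s v) (s v)
  set k : V → Fin 2 := fun v => Fin.ofNat 2 (xCorr O g s v) with hk
  -- The factors come from reordering X and Z at the outputs, from the bras absorbing their Paulis,
  -- and from the entangler evaluated on the shift `k` itself.
  refine ⟨(∏ v : O, (-1) ^ ((k v : ℕ) * zCorr G O g s v)) * (∏ v with v ∉ O, c v) *
    entanglerPhase G k, ?_, ?_⟩
  · refine mul_ne_zero (mul_ne_zero ?_ ?_) (entanglerPhase_ne_zero G k)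
    · exact Finset.prod_ne_zero_iff.2 fun v _ => pow_ne_zero _ (by simp)
    · exact Finset.prod_ne_zero_iff.2 fun v _ => hc0 v
  ext o a
  rw [Matrix.smul_apply, patternBranch_apply, patternMap_apply, smul_eq_mul, Finset.mul_sum,
    ← Equiv.sum_comp (Equiv.addRight k)]
  refine Finset.sum_congr rfl fun y _ => ?_
  simp only [Equiv.coe_addRight]
  rw [prepare_ketPlus_add y k a fun v hv => by simp [hk, xCorr_eq_zero G hg s hv],
    entanglerPhase_add]
  -- The Z's created by the shift split into those at outputs, removed by the final corrections, and
  -- those at measured vertices, absorbed by the bras.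
  have hZ : ∏ v, ∏ w with G.Adj v w, czSign (y v) (k w) =
      (∏ v : O, (-1 : ℂ) ^ ((y v : ℕ) * zCorr G O g s v)) *
        ∏ v with v ∉ O, (-1 : ℂ) ^ ((y v : ℕ) * (zCorr G O g s v + s v)) := by
    have h1 : ∀ v, ∏ w with G.Adj v w, czSign (y v) (k w) =
        (-1 : ℂ) ^ ((y v : ℕ) * (zCorr G O g s v + if v ∈ O then 0 else (s v : ℕ))) := by
      intro v
      simp only [czSign_eq_pow, hk, neg_one_pow_mul_ofNat]
      rw [Finset.prod_pow_eq_pow_sum, ← Finset.mul_sum, mul_comm, pow_mul,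
        neg_one_pow_sum_xCorr G hg s v, ← pow_mul, mul_comm]
    simp only [h1]
    rw [← Finset.prod_filter_mul_prod_filter_not Finset.univ (fun v => v ∈ O)]
    congr 1
    · rw [Finset.filter_univ_mem, Finset.prod_coe_sort O
        (fun v => (-1 : ℂ) ^ ((y v : ℕ) * zCorr G O g s v))]
      refine Finset.prod_congr rfl fun v hv => ?_
      rw [if_pos hv, add_zero]
    · refine Finset.prod_congr rfl fun v hv => ?_
      rw [if_neg (Finset.mem_filter.1 hv).2]
  rw [hZ]
  have hM : (∏ v with v ∉ O, star (ketXY ((-1) ^ xCorr O g s v * α v +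
      zCorr G O g s v * Real.pi) (s v) ((y + k) v))) *
      ∏ v with v ∉ O, (-1 : ℂ) ^ ((y v : ℕ) * (zCorr G O g s v + s v)) =
      (∏ v with v ∉ O, c v) * ∏ v with v ∉ O, star (ketXY (α v) 0 (y v)) := by
    rw [← Finset.prod_mul_distrib, ← Finset.prod_mul_distrib]
    exact Finset.prod_congr rfl fun v _ => hc v (y v)
  have hO : (∏ v : O, (pauliX ^ xCorr O g s v * pauliZ ^ zCorr G O g s v) (o v) ((y + k) v)) *
      ∏ v : O, (-1 : ℂ) ^ ((y v : ℕ) * zCorr G O g s v) =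
      if (fun v : O => y v) = o then ∏ v : O, (-1) ^ ((k v : ℕ) * zCorr G O g s v) else 0 := by
    rw [← Finset.prod_mul_distrib]
    simp only [pauliX_pow_mul_pauliZ_pow_apply]
    have hkk : ∀ v, (y + k) v + Fin.ofNat 2 (xCorr O g s v) = y v := by
      intro v
      change y v + k v + k v = y v
      rw [add_assoc, fin_two_add_self, add_zero]
    simp only [hkk]
    split_ifs with ho
    · refine Finset.prod_congr rfl fun v _ => ?_
      rw [if_pos (congrFun ho v).symm, Pi.add_apply]
      have : ∀ a b : Fin 2, (-1 : ℂ) ^ (((a + b : Fin 2) : ℕ) * zCorr G O g s v) *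
          (-1) ^ ((a : ℕ) * zCorr G O g s v) = (-1) ^ ((b : ℕ) * zCorr G O g s v) := by
        intro a b
        fin_cases a <;> fin_cases b <;> simp [← mul_pow]
      exact this _ _
    · obtain ⟨v, hv⟩ := Function.ne_iff.1 ho
      apply Finset.prod_eq_zero (Finset.mem_univ v)
      rw [if_neg (Ne.symm hv), zero_mul]
  trans (if (fun v : O => y v) = o then ∏ v : O, (-1) ^ ((k v : ℕ) * zCorr G O g s v) else 0) *
      ((∏ v with v ∉ O, c v) * ∏ v with v ∉ O, star (ketXY (α v) 0 (y v))) *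
      (entanglerPhase G y * entanglerPhase G k) *
      prepare (fun i : I => (i : V)) (fun _ => ketPlus) y a
  · rw [← hO, ← hM]
    ring
  · split_ifs
    · ring
    · simp

end Patterns

/-! ### Orthogonality of branches and the isometry -/

section Isometry

variable {V : Type*} [Fintype V] [DecidableEq V] (G : SimpleGraph V) [DecidableRel G.Adj]
  {I O : Finset V} {g : V → Finset V} {prec : V → V → Prop}

/-- The state on which the register is projected at `v` if `v` is measured with outcomes `s`, and
the basis state `s v` if `v` is an output. -/
def branchKet (O : Finset V) (g : V → Finset V) (α : V → ℝ) (s : V → Fin 2) (v : V) :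
    Fin 2 → ℂ :=
  if v ∈ O then fun t => if t = s v then 1 else 0
  else ketXY ((-1) ^ xCorr O g s v * α v + zCorr G O g s v * Real.pi) (s v)

/-- The matrix whose columns are the product states defined by `branchKet`. -/
def branchBasis (O : Finset V) (g : V → Finset V) (α : V → ℝ) :
    Matrix (V → Fin 2) (V → Fin 2) ℂ :=
  fun y s => ∏ v, branchKet G O g α s v (y v)

/-- Causality of the adaptation: by (g-1) every `u` that contributes at `v` precedes `v`. For
`zCorr_congr` this is (g-3). -/
theorem xCorr_congr (hg : IsGFlow G I O g prec) {s s' : V → Fin 2} {v : V}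
    (h : ∀ u, u ∉ O → prec u v → s u = s' u) : xCorr O g s v = xCorr O g s' v := by
  refine Finset.sum_congr rfl fun u hu => ?_
  simp only [Finset.mem_filter, Finset.mem_univ, true_and] at hu
  rw [h u hu.1 (hg.g1 u hu.1 v hu.2)]

theorem zCorr_congr (hg : IsGFlow G I O g prec) {s s' : V → Fin 2} {v : V}
    (h : ∀ u, u ∉ O → prec u v → s u = s' u) : zCorr G O g s v = zCorr G O g s' v := by
  refine Finset.sum_congr rfl fun u hu => ?_
  simp only [Finset.mem_filter, Finset.mem_univ, true_and] at hu
  rw [h u hu.1 ((hg.g3 u hu.1 v hu.2.2).resolve_left hu.2.1)]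

theorem branchKet_normalized (α : V → ℝ) (s : V → Fin 2) (v : V) :
    ∑ t, star (branchKet G O g α s v t) * branchKet G O g α s v t = 1 := by
  unfold branchKet
  split_ifs
  · simp
  · simpa using ketXY_orthonormal _ (s v) (s v)

/-- The branches are orthogonal: they are distinguished at a minimal vertex where the outcomes
differ, since there the measurement bases agree. -/
theorem branchBasis_isometry (hg : IsGFlow G I O g prec) (α : V → ℝ) :
    (branchBasis G O g α)ᴴ * branchBasis G O g α = 1 := by
  ext s s'
  simp only [mul_apply, conjTranspose_apply, branchBasis, star_prod, ← Finset.prod_mul_distrib]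
  have h := Finset.prod_univ_sum (fun _ : V => (Finset.univ : Finset (Fin 2)))
    (fun v t => star (branchKet G O g α s v t) * branchKet G O g α s' v t)
  rw [Fintype.piFinset_univ] at h
  rw [← h, one_apply]
  split_ifs with hs
  · subst hs
    exact Finset.prod_eq_one fun v _ => branchKet_normalized G α s v
  · have : IsStrictOrder V prec :=
      { irrefl := hg.irrefl, trans := hg.trans }
    have hwf : WellFounded prec := Finite.wellFounded_of_trans_of_irrefl prec
    obtain ⟨v, hv, hmin⟩ := hwf.has_min {v | s v ≠ s' v} (Function.ne_iff.1 hs)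
    have hpre : ∀ u, u ∉ O → prec u v → s u = s' u := fun u _ huv => by
      by_contra hu
      exact hmin u hu huv
    apply Finset.prod_eq_zero (Finset.mem_univ v)
    unfold branchKet
    split_ifs with hO
    · simp
      tauto
    · rw [xCorr_congr G hg hpre, zCorr_congr G hg hpre, ketXY_orthonormal, if_neg hv]

theorem star_branchBasis (α : V → ℝ) (x s : V → Fin 2) :
    star (branchBasis G O g α x s) =
      star (prepare (fun o : O => (o : V)) (fun v =>
        ketXY ((-1) ^ xCorr O g s v * α v + zCorr G O g s v * Real.pi) (s v)) x
          (fun o : O => s o)) := by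
  rw [prepare_coe_apply_eq_prod]
  congr 1
  refine Finset.prod_congr rfl fun v _ => ?_
  unfold branchKet
  by_cases h : v ∈ O <;> simp [h]

/-- The branch without the final corrections. -/
def uncorrectedBranch (I O : Finset V) (g : V → Finset V) (α : V → ℝ) (s : V → Fin 2) :
    Matrix (O → Fin 2) (I → Fin 2) ℂ :=
  (prepare (fun o : O => (o : V)) fun v =>
        ketXY ((-1) ^ xCorr O g s v * α v + zCorr G O g s v * Real.pi) (s v))ᴴ
    * entangler G
    * prepare (fun i : I => (i : V)) (fun _ => ketPlus)

/-- The final Paulis are unitary, so they drop out of the Gram matrix. -/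
theorem patternBranch_gram (α : V → ℝ) (s : V → Fin 2) :
    (patternBranch G I O g α s)ᴴ * patternBranch G I O g α s =
      (uncorrectedBranch G I O g α s)ᴴ * uncorrectedBranch G I O g α s := by
  have h : patternBranch G I O g α s =
      tensor (fun o : O => pauliX ^ xCorr O g s o * pauliZ ^ zCorr G O g s o) *
        uncorrectedBranch G I O g α s := by
    unfold patternBranch uncorrectedBranch
    simp only [Matrix.mul_assoc]
  rw [h, conjTranspose_mul, Matrix.mul_assoc, ← Matrix.mul_assoc _ (tensor _),
    tensor_conjTranspose, tensor_mul]
  simp only [pauli_unitary, tensor_one, Matrix.one_mul]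

/-- This frees the values of `s` at outputs to serve as labels of the output basis in
`sum_patternBranch_gram`. -/
theorem uncorrectedBranch_congr (hg : IsGFlow G I O g prec) (α : V → ℝ) {s s' : V → Fin 2}
    (h : ∀ u, u ∉ O → s u = s' u) :
    uncorrectedBranch G I O g α s = uncorrectedBranch G I O g α s' := by
  unfold uncorrectedBranch
  congr 3
  ext x b
  rw [prepare_coe_apply, prepare_coe_apply]
  split_ifs
  · refine Finset.prod_congr rfl fun v hv => ?_
    rw [xCorr_congr G hg fun u hu _ => h u hu, zCorr_congr G hg fun u hu _ => h u hu,
      h v (Finset.mem_filter.1 hv).2]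
  · rfl

theorem entangler_isometry : (entangler G)ᴴ * entangler G = 1 := by
  unfold entangler
  rw [diagonal_conjTranspose, diagonal_mul_diagonal, ← diagonal_one]
  congr 1
  funext x
  simp only [Pi.star_apply, star_prod, ← Finset.prod_mul_distrib, czPhase_star_mul_self,
    Finset.prod_const_one]

/-- The probabilities of the branches add up to one. -/
theorem sum_patternBranch_gram (hg : IsGFlow G I O g prec) (α : V → ℝ) :
    ∑ n : {v // v ∉ O} → Fin 2,
      (patternBranch G I O g α fun v => if h : v ∈ O then 0 else n ⟨v, h⟩)ᴴ *
        patternBranch G I O g α (fun v => if h : v ∈ O then 0 else n ⟨v, h⟩) = 1 := by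
  set B := entangler G * prepare (fun i : I => (i : V)) (fun _ => ketPlus) with hB
  have hBB : Bᴴ * B = 1 := by
    rw [hB, conjTranspose_mul, Matrix.mul_assoc, ← Matrix.mul_assoc _ (entangler G),
      entangler_isometry, Matrix.one_mul, prepare_coe_isometry _ _ fun _ => ketPlus_normalized]
  set Q := branchBasis G O g α with hQ
  -- `Q` is square, so its orthonormal columns are also complete.
  have hQQ : Q * Qᴴ = 1 := mul_eq_one_comm.1 (branchBasis_isometry G hg α)
  have h1 : (Qᴴ * B)ᴴ * (Qᴴ * B) = 1 := by
    rw [conjTranspose_mul, conjTranspose_conjTranspose, Matrix.mul_assoc, ← Matrix.mul_assoc Q,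
      hQQ, Matrix.one_mul, hBB]
  -- The measured bits of `s` select a branch, and the output bits select a row of its matrix.
  have h2 : ∀ (s : V → Fin 2) (a : I → Fin 2),
      (Qᴴ * B) s a = uncorrectedBranch G I O g α s (fun o : O => s o) a := by
    intro s a
    unfold uncorrectedBranch
    rw [Matrix.mul_assoc, mul_apply, mul_apply]
    refine Finset.sum_congr rfl fun x _ => ?_
    rw [conjTranspose_apply, conjTranspose_apply, hQ, star_branchBasis]
  simp only [patternBranch_gram]
  rw [← h1]
  ext a b
  rw [Matrix.sum_apply, mul_apply,
    ← Equiv.sum_comp (Equiv.piEquivPiSubtypeProd (fun v => v ∈ O) (fun _ => Fin 2)).symm,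
    Fintype.sum_prod_type_right]
  refine Finset.sum_congr rfl fun n _ => ?_
  rw [mul_apply]
  refine Finset.sum_congr rfl fun o _ => ?_
  rw [conjTranspose_apply, conjTranspose_apply, h2, h2]
  have h3 : uncorrectedBranch G I O g α (fun v => if h : v ∈ O then 0 else n ⟨v, h⟩) =
      uncorrectedBranch G I O g α
        ((Equiv.piEquivPiSubtypeProd (fun v => v ∈ O) (fun _ => Fin 2)).symm (o, n)) := by
    apply uncorrectedBranch_congr G hg
    intro u hu
    simp [Equiv.piEquivPiSubtypeProd, hu]
  have h4 : (fun v : O => (Equiv.piEquivPiSubtypeProd (fun v => v ∈ O) (fun _ => Fin 2)).symm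
      (o, n) v) = o := by
    funext v
    simp [Equiv.piEquivPiSubtypeProd]
  rw [h3, h4]

/-- The map of the all-`+` branch is proportional to an isometry. -/
theorem exists_smul_patternMap_gram (hg : IsGFlow G I O g prec) (α : V → ℝ) :
    ∃ R : ℝ, 0 < R ∧ (R : ℂ) • ((patternMap G I O α)ᴴ * patternMap G I O α) = 1 := by
  choose c hc0 hc using exists_patternBranch_eq_smul (I := I) G hg α
  -- The Gram matrix of a branch with scalar `c` is `‖c‖ ^ 2` times that of the all-`+` branch.
  refine ⟨∑ n : {v // v ∉ O} → Fin 2,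
    ‖c fun v => if h : v ∈ O then 0 else n ⟨v, h⟩‖ ^ 2, ?_, ?_⟩
  · exact Finset.sum_pos (fun n _ => pow_pos (norm_pos_iff.2 (hc0 _)) 2) Finset.univ_nonempty
  · rw [← sum_patternBranch_gram G hg α, Complex.ofReal_sum, Finset.sum_smul]
    refine Finset.sum_congr rfl fun n _ => ?_
    rw [hc, conjTranspose_smul, Matrix.smul_mul, Matrix.mul_smul, smul_smul, RCLike.star_def, Complex.conj_mul']
    push_cast
    rfl

end Isometry

/-! ### Positions on the paths of a cover -/

namespace PathCover

section Paths

variable {V : Type*} {G : SimpleGraph V} {I O : Finset V} (P : PathCover G I O)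

theorem mem_pathOf (v : V) : v ∈ (P.pathOf v).1 := (P.cover v).choose_spec.1.2

variable {P} in
theorem Step.adj {u v : V} (h : P.Step u v) : G.Adj u v := by
  obtain ⟨p, hp, hinf⟩ := h
  have := (P.chain p hp).infix hinf
  simpa using this

theorem pathOf_eq {v : V} {p : List V} (hp : p ∈ P.paths) (hv : v ∈ p) :
    P.pathOf v = ⟨p, hp⟩ :=
  Subtype.ext ((P.cover v).unique ⟨(P.pathOf v).2, P.mem_pathOf v⟩ ⟨hp, hv⟩)

variable [DecidableEq V]

/-- The position of a vertex on its path. -/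
def rank (v : V) : ℕ := (P.pathOf v).1.idxOf v

theorem rank_lt (v : V) : P.rank v < (P.pathOf v).1.length :=
  List.idxOf_lt_length_of_mem (P.mem_pathOf v)

theorem getElem_rank (v : V) : (P.pathOf v).1[P.rank v]'(P.rank_lt v) = v :=
  List.getElem_idxOf _

theorem rank_getElem {p : List V} (hp : p ∈ P.paths) {i : ℕ} (hi : i < p.length) :
    P.rank p[i] = i := by
  unfold rank
  rw [P.pathOf_eq hp (List.getElem_mem hi)]
  exact (P.nodup p hp).idxOf_getElem i hi

theorem eq_of_rank_eq {u v : V} (hp : P.pathOf u = P.pathOf v) (hr : P.rank u = P.rank v) :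
    u = v := by
  rw [← P.getElem_rank u, ← P.getElem_rank v]
  congr 1
  rw [hp]

/-- Paths have no repeated vertices and are disjoint, so a step is determined by indices; later path
arguments become arithmetic of `rank`. -/
theorem step_iff {u v : V} : P.Step u v ↔ P.pathOf u = P.pathOf v ∧ P.rank v = P.rank u + 1 := by
  constructor
  · rintro ⟨p, hp, a, b, hab⟩
    have hu : p[a.length]? = some u := by rw [← hab]; simp
    have hv : p[a.length + 1]? = some v := by rw [← hab]; simp
    obtain ⟨hu1, rfl⟩ := List.getElem?_eq_some_iff.1 hu
    obtain ⟨hv1, rfl⟩ := List.getElem?_eq_some_iff.1 hv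
    rw [P.rank_getElem hp, P.rank_getElem hp, P.pathOf_eq hp (List.getElem_mem hu1),
      P.pathOf_eq hp (List.getElem_mem hv1)]
    exact ⟨rfl, rfl⟩
  · rintro ⟨h1, h2⟩
    refine ⟨(P.pathOf v).1, (P.pathOf v).2, ?_⟩
    have hv := P.rank_lt v
    have hu : P.rank u < (P.pathOf v).1.length := by omega
    have hu' : (P.pathOf v).1[P.rank u] = u := by
      have := P.getElem_rank u
      simpa only [h1] using this
    have hv' : (P.pathOf v).1[P.rank u + 1]'(by omega) = v := by
      have := P.getElem_rank v
      simpa only [h2] using this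
    refine ⟨(P.pathOf v).1.take (P.rank u), (P.pathOf v).1.drop (P.rank u + 2), ?_⟩
    conv_rhs => rw [← List.take_append_drop (P.rank u) (P.pathOf v).1,
      List.drop_eq_getElem_cons hu, List.drop_eq_getElem_cons (by omega), hu', hv']
    simp

theorem mem_output_iff (v : V) : v ∈ O ↔ P.rank v + 1 = (P.pathOf v).1.length := by
  have hne := P.ne_nil _ (P.pathOf v).2
  have hlen := List.length_pos_iff.2 hne
  rw [P.output _ (P.pathOf v).2 v (P.mem_pathOf v), List.getLast?_eq_getElem?]
  constructor
  · intro h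
    obtain ⟨h1, h2⟩ := List.getElem?_eq_some_iff.1 h
    have := P.rank_getElem (P.pathOf v).2 h1
    rw [h2] at this
    omega
  · intro h
    have h1 := P.getElem_rank v
    rw [List.getElem?_eq_some_iff]
    refine ⟨by omega, ?_⟩
    conv_rhs => rw [← h1]
    congr 1
    omega

theorem rank_eq_zero {v : V} (hv : v ∈ I) : P.rank v = 0 := by
  have h := P.input _ (P.pathOf v).2 v (P.mem_pathOf v) hv
  rw [List.head?_eq_getElem?] at h
  obtain ⟨h1, h2⟩ := List.getElem?_eq_some_iff.1 h
  have := P.rank_getElem (P.pathOf v).2 h1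
  rwa [h2] at this

theorem exists_step {v : V} (hv : v ∉ O) : ∃ w, P.Step v w := by
  have h1 := mt (P.mem_output_iff v).2 hv
  have h2 := P.rank_lt v
  have h3 : P.rank v + 1 < (P.pathOf v).1.length := by omega
  refine ⟨(P.pathOf v).1[P.rank v + 1], P.step_iff.2 ⟨?_, ?_⟩⟩
  · rw [P.pathOf_eq (P.pathOf v).2 (List.getElem_mem h3)]
  · rw [P.rank_getElem (P.pathOf v).2]

theorem exists_pred {v : V} (hv : P.rank v ≠ 0) : ∃ u, P.Step u v := by
  have h2 := P.rank_lt v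
  have h3 : P.rank v - 1 < (P.pathOf v).1.length := by omega
  refine ⟨(P.pathOf v).1[P.rank v - 1], P.step_iff.2 ⟨?_, ?_⟩⟩
  · rw [P.pathOf_eq (P.pathOf v).2 (List.getElem_mem h3)]
  · rw [P.rank_getElem (P.pathOf v).2]
    omega

variable {P} in
theorem Step.not_mem_output {u v : V} (h : P.Step u v) : u ∉ O := by
  obtain ⟨h1, h2⟩ := P.step_iff.1 h
  rw [P.mem_output_iff, h1]
  have := P.rank_lt v
  omega

/-- The successor of a vertex on its path; outputs are fixed. -/
def succ (v : V) : V := open Classical in if h : ∃ w, P.Step v w then h.choose else v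

theorem step_succ {v : V} (hv : v ∉ O) : P.Step v (P.succ v) := by
  have h := P.exists_step hv
  unfold succ
  rw [dif_pos h]
  exact h.choose_spec

theorem pathOf_succ {v : V} (hv : v ∉ O) : P.pathOf (P.succ v) = P.pathOf v :=
  (P.step_iff.1 (P.step_succ hv)).1.symm

theorem rank_succ {v : V} (hv : v ∉ O) : P.rank (P.succ v) = P.rank v + 1 :=
  (P.step_iff.1 (P.step_succ hv)).2

theorem succ_eq {u v : V} (h : P.Step u v) : P.succ u = v := by
  have hu := h.not_mem_output
  obtain ⟨h1, h2⟩ := P.step_iff.1 h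
  exact P.eq_of_rank_eq ((P.pathOf_succ hu).trans h1) ((P.rank_succ hu).trans h2.symm)

/-- Each path contains exactly one output, its last vertex. Thus the post-selected qubits are
exactly the ancillas. -/
theorem pathOf_output_bijective : Function.Bijective fun o : O => P.pathOf o := by
  constructor
  · intro i j h
    refine Subtype.ext (P.eq_of_rank_eq h ?_)
    have h1 := (P.mem_output_iff i).1 i.2
    have h2 := (P.mem_output_iff j).1 j.2
    have h' : P.pathOf i = P.pathOf j := h
    rw [h'] at h1
    omega
  · rintro ⟨p, hp⟩
    have hlen := List.length_pos_iff.2 (P.ne_nil p hp)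
    have hlt : p.length - 1 < p.length := by omega
    have h1 := P.pathOf_eq hp (List.getElem_mem hlt)
    refine ⟨⟨p[p.length - 1], ?_⟩, h1⟩
    rw [P.mem_output_iff, P.rank_getElem hp, h1]
    simp only
    omega

end Paths

/-! ### Existence of gate sequences -/

section GateSequences

variable {V : Type*} [Fintype V] [DecidableEq V] {G : SimpleGraph V} {I O : Finset V}
  (P : PathCover G I O)

/-- Gates as a subtype of a finite sum type. -/
def gateEquiv : P.Gate ≃ {v // v ∉ O} ⊕ P.offGraph.Dart ⊕
    {t : Sym2 P.offGraph.Dart // ∃ d, t = s(d, d.symm)} where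
  toFun
    | .j v hv => .inl ⟨v, hv⟩
    | .link d => .inr (.inl d)
    | .mid t ht => .inr (.inr ⟨t, ht⟩)
  invFun
    | .inl v => .j v.1 v.2
    | .inr (.inl d) => .link d
    | .inr (.inr t) => .mid t.1 t.2
  left_inv := by rintro (_ | _ | _) <;> rfl
  right_inv := by rintro (_ | _ | _) <;> rfl

instance : Fintype P.Gate :=
  open Classical in Fintype.ofEquiv _ P.gateEquiv.symm

instance : DecidableEq P.Gate := Classical.decEq _

/-- A time at which a gate can be applied. -/
def Gate.time {P : PathCover G I O} : P.Gate → ℕ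
  | .j v _ => 2 * P.rank v + 1
  | .link d => 2 * P.rank d.fst
  | .mid _ _ => 0

/-- Position `v!` has the even time `2 * rank v`, and the `J` gates of `v` and of its predecessor
have the odd times on either side. -/
theorem Gate.Before.time_lt {a b : P.Gate} (h : a.Before b) : a.time < b.time := by
  cases a <;> cases b <;> simp only [Gate.Before] at h <;> simp only [Gate.time]
  · have := (P.step_iff.1 h).2
    omega
  · have := (P.step_iff.1 h).2
    omega
  · rw [h]
    omega

theorem exists_isGateSequence : ∃ L : List P.Gate, P.IsGateSequence L := by
  let r : P.Gate → P.Gate → Prop := fun a b => a.time ≤ b.time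
  have : DecidableRel r := fun a b => inferInstanceAs (Decidable (a.time ≤ b.time))
  have : Std.Total r := ⟨fun a b => le_total a.time b.time⟩
  have : IsTrans P.Gate r := ⟨fun a b c => le_trans (a := a.time)⟩
  have hperm := List.perm_insertionSort r (Finset.univ : Finset P.Gate).toList
  refine ⟨(Finset.univ : Finset P.Gate).toList.insertionSort r, ?_, ?_, ?_⟩
  · exact hperm.nodup_iff.2 (Finset.nodup_toList _)
  · intro a
    rw [hperm.mem_iff]
    simp
  · refine (List.pairwise_insertionSort r _).imp fun {a b} hab hba => ?_
    exact absurd (Gate.Before.time_lt P hba) (not_lt.2 hab)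

end GateSequences

end PathCover

/-! ### Evolution of the circuit path sum -/

namespace PathCover

variable {V : Type*} [Fintype V] [DecidableEq V] {G : SimpleGraph V} {I O : Finset V}
  {P : PathCover G I O}

/-- The contribution of a gate to a path sum, where `x v` is the bit carried by the wire of `v` at
the position `v!` and `q` are the bits of the ancillas. -/
def Gate.weight (α : V → ℝ) (x : V → Fin 2) (q : P.offGraph.Dart → Fin 2) : P.Gate → ℂ
  | .j v _ => jMatrix (α v) (x (P.succ v)) (x v)
  | .link d => czSign (x d.fst) (q d)
  | .mid t _ => czPhase t q

/-- The assignment `x` of bits to positions agrees with the bits `y` of the wires after the gates in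
`S`: a position from which the wire has not been advanced carries the current bit. -/
def Consistent (S : Finset P.Gate) (x : V → Fin 2) (y : {p // p ∈ P.paths} → Fin 2) : Prop :=
  ∀ v, (∀ hv : v ∉ O, Gate.j v hv ∉ S) → x v = y (P.pathOf v)

/-- The normalization of the input preparation of the circuit. -/
def inputNorm (P : PathCover G I O) : ℂ :=
  open Classical in
  ∏ w : P.Qubit with w ∉ Set.range (fun i : I => (Sum.inl (P.pathOf i) : P.Qubit)), ketPlus 0

open Classical in
/-- The path sum of the circuit after the gates in `S`. -/
def amplitude (α : V → ℝ) (S : Finset P.Gate) : Matrix (P.Qubit → Fin 2) (I → Fin 2) ℂ :=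
  fun y a => P.inputNorm * ∑ x : V → Fin 2,
    if (fun i : I => x i) = a ∧ Consistent S x (y ∘ Sum.inl) then
      ∏ b ∈ S, b.weight α x (y ∘ Sum.inr) else 0

/-- Before any gate, `Consistent` ties every position to the current bit of its wire, so a single
assignment survives. -/
theorem amplitude_empty (α : V → ℝ) :
    amplitude α (∅ : Finset P.Gate) =
      prepare (W := P.Qubit) (fun i : I => (Sum.inl (P.pathOf i) : P.Qubit)) (fun _ => ketPlus) := by
  ext y a
  have hc : ∀ x : V → Fin 2, Consistent (∅ : Finset P.Gate) x (y ∘ Sum.inl) ↔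
      x = fun v => y (Sum.inl (P.pathOf v)) := by
    intro x
    simp [Consistent, funext_iff]
  simp only [amplitude, prepare_apply, hc, Finset.prod_empty]
  rw [Finset.sum_eq_single fun v => y (Sum.inl (P.pathOf v))]
  · simp only [and_true, Function.comp_def]
    split_ifs
    · rw [mul_one]; rfl
    · rw [mul_zero]
  · intro x _ hx
    rw [if_neg fun h => hx h.2]
  · simp

/-- A set of gates that contains all gates that have to act before one of its gates. -/
def PastClosed (S : Finset P.Gate) : Prop := ∀ a b : P.Gate, a.Before b → b ∈ S → a ∈ S

/-- `Before` relates only consecutive `J` gates; induction on the distance `n` reaches all earlier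
ones on the wire. -/
theorem PastClosed.exists_j_mem {S : Finset P.Gate} (hS : PastClosed S) {v : V} {hv : v ∉ O}
    (hmem : Gate.j v hv ∈ S) (n : ℕ) :
    ∀ u, P.pathOf u = P.pathOf v → P.rank u + n = P.rank v → ∃ hu : u ∉ O, Gate.j u hu ∈ S := by
  induction n with
  | zero =>
    intro u hp hr
    obtain rfl := P.eq_of_rank_eq hp hr
    exact ⟨hv, hmem⟩
  | succ n ih =>
    intro u hp hr
    have hu : u ∉ O := by
      rw [P.mem_output_iff, hp]
      have := P.rank_lt v
      omega
    obtain ⟨hs, hs'⟩ := ih (P.succ u) ((P.pathOf_succ hu).trans hp)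
      (by rw [P.rank_succ hu]; omega)
    exact ⟨hu, hS (.j u hu) (.j _ hs) (P.step_succ hu) hs'⟩

theorem PastClosed.j_mem {S : Finset P.Gate} (hS : PastClosed S) {u v : V} {hu : u ∉ O}
    {hv : v ∉ O} (hmem : Gate.j v hv ∈ S) (hp : P.pathOf u = P.pathOf v)
    (hr : P.rank u ≤ P.rank v) : Gate.j u hu ∈ S :=
  (hS.exists_j_mem hmem (P.rank v - P.rank u) u hp (by omega)).2

theorem czPhase_map_inr {A B : Type*} [Fintype A] [Fintype B] [DecidableEq A] [DecidableEq B]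
    (t : Sym2 B) (y : A ⊕ B → Fin 2) : czPhase (t.map Sum.inr) y = czPhase t (y ∘ Sum.inr) := by
  obtain ⟨a, b⟩ := t
  exact (czPhase_mk (W := A ⊕ B) _ _ y).trans (czPhase_mk a b (y ∘ Sum.inr)).symm

/-- A diagonal gate advances no wire, so the admissible assignments stay the same and only the
weight gains a factor. -/
theorem diagonal_mul_amplitude (α : V → ℝ) (S : Finset P.Gate) (b : P.Gate)
    (hb : b ∉ S) (hj : ∀ v hv, b ≠ .j v hv) (D : (P.Qubit → Fin 2) → ℂ)
    (hD : ∀ x y, Consistent S x (y ∘ Sum.inl) → D y = b.weight α x (y ∘ Sum.inr)) :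
    diagonal D * amplitude α S = amplitude α (insert b S) := by
  ext y a
  rw [diagonal_mul]
  simp only [amplitude]
  rw [mul_left_comm, Finset.mul_sum]
  congr 1
  refine Finset.sum_congr rfl fun x _ => ?_
  have hc : Consistent (insert b S) x (y ∘ Sum.inl) ↔ Consistent S x (y ∘ Sum.inl) := by
    have h : ∀ v hv, Gate.j v hv ∈ insert b S ↔ Gate.j v hv ∈ S := fun v hv => by
      rw [Finset.mem_insert, or_iff_right (hj v hv).symm]
    simp only [Consistent, h]
  rw [hc, mul_ite, mul_zero]
  split_ifs with h
  · rw [Finset.prod_insert hb, hD x y h.2]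
  · rfl

open Classical in
/-- The assignment `x` with the bits at the positions that follow `v` on its wire replaced by `t`. -/
def overrideAfter (P : PathCover G I O) (v : V) (t : Fin 2) (x : V → Fin 2) : V → Fin 2 :=
  fun w => if P.pathOf w = P.pathOf v ∧ P.rank v < P.rank w then t else x w

theorem overrideAfter_of_le {v w : V} (t : Fin 2) (x : V → Fin 2)
    (h : P.pathOf w = P.pathOf v → P.rank w ≤ P.rank v) : P.overrideAfter v t x w = x w :=
  if_neg fun h' => absurd h'.2 (not_lt.2 (h h'.1))

theorem overrideAfter_of_lt {v w : V} (t : Fin 2) (x : V → Fin 2)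
    (h : P.pathOf w = P.pathOf v) (h' : P.rank v < P.rank w) : P.overrideAfter v t x w = t :=
  if_pos ⟨h, h'⟩

theorem overrideAfter_input (v : V) (t : Fin 2) (x : V → Fin 2) :
    (fun i : I => P.overrideAfter v t x i) = fun i : I => x i := by
  funext i
  exact overrideAfter_of_le t x fun _ => by rw [P.rank_eq_zero i.2]; exact Nat.zero_le _

theorem overrideAfter_overrideAfter {v : V} {t t' : Fin 2} {x : V → Fin 2}
    (h : ∀ w, P.pathOf w = P.pathOf v → P.rank v < P.rank w → x w = t) :
    P.overrideAfter v t (P.overrideAfter v t' x) = x := by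
  funext w
  by_cases hw : P.pathOf w = P.pathOf v ∧ P.rank v < P.rank w
  · rw [overrideAfter_of_lt _ _ hw.1 hw.2, h w hw.1 hw.2]
  · have hw' : P.pathOf w = P.pathOf v → P.rank w ≤ P.rank v := fun h1 =>
      not_lt.1 fun h2 => hw ⟨h1, h2⟩
    rw [overrideAfter_of_le _ _ hw', overrideAfter_of_le _ _ hw']

/-- Before the gate, `v` and all later positions of the wire carry its current bit. Afterwards `x v`
is a free summation bit, matching the sum over `t` in the matrix product, and the later positions
carry the new bit. Overwriting those positions by `overrideAfter` is a bijection between the two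
sets of assignments, and no gate in `S` reads them because `S` is past-closed. -/
theorem jGate_mul_amplitude (α : V → ℝ) (S : Finset P.Gate) (v : V) (hv : v ∉ O)
    (hnot : Gate.j v hv ∉ S) (hS : PastClosed S) (hS' : PastClosed (insert (.j v hv) S)) :
    gateOn (W := P.Qubit) (Sum.inl (P.pathOf v)) (jMatrix (α v)) * amplitude α S =
      amplitude α (insert (.j v hv) S) := by
  have h1 : ∀ w hw, P.pathOf w = P.pathOf v → P.rank w < P.rank v → Gate.j w hw ∈ S := by
    intro w hw hp hr
    have := hS'.j_mem (hu := hw) (Finset.mem_insert_self _ _) hp hr.le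
    refine (Finset.mem_insert.1 this).resolve_left fun h => ?_
    obtain rfl : w = v := by injection h
    exact lt_irrefl _ hr
  have h2 : ∀ w hw, P.pathOf w = P.pathOf v → P.rank v ≤ P.rank w → Gate.j w hw ∉ S :=
    fun w hw hp hr hmem => hnot (hS.j_mem hmem hp.symm hr)
  have h3 : ∀ d, Gate.link d ∈ S → P.pathOf d.fst = P.pathOf v → P.rank d.fst ≤ P.rank v := by
    intro d hd hp
    by_contra! hlt
    -- A link beyond `v` would force the `J` gate just before it into `S`, although that gate sits
    -- at `v` or later.
    obtain ⟨u, hu⟩ := P.exists_pred (v := d.fst) (by omega)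
    obtain ⟨hu1, hu2⟩ := P.step_iff.1 hu
    refine h2 u hu.not_mem_output (hu1.trans hp) (by omega) (hS _ _ ?_ hd)
    exact hu
  have hcase : ∀ w, P.pathOf w = P.pathOf v → (∀ hw : w ∉ O, Gate.j w hw ∉ S) →
      w = v ∨ P.rank v < P.rank w := by
    intro w hp hw
    rcases lt_trichotomy (P.rank w) (P.rank v) with h | h | h
    · have hwO : w ∉ O := by
        rw [P.mem_output_iff, hp]
        have := P.rank_lt v
        omega
      exact absurd (h1 w hwO hp h) (hw hwO)
    · exact .inl (P.eq_of_rank_eq hp h)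
    · exact .inr h
  have hinsert : ∀ w, (∀ hw : w ∉ O, Gate.j w hw ∉ insert (Gate.j v hv) S) ↔
      w ≠ v ∧ ∀ hw : w ∉ O, Gate.j w hw ∉ S := by
    intro w
    constructor
    · intro h
      refine ⟨?_, fun hw hmem => h hw (Finset.mem_insert_of_mem hmem)⟩
      rintro rfl
      exact h hv (Finset.mem_insert_self _ _)
    · rintro ⟨hne, h⟩ hw hmem
      rcases Finset.mem_insert.1 hmem with h' | h'
      · injection h' with h'
        exact hne h'
      · exact h hw h'
  have hafter : ∀ w, P.pathOf w = P.pathOf v → P.rank v < P.rank w →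
      w ≠ v ∧ ∀ hw : w ∉ O, Gate.j w hw ∉ S := by
    intro w hp hr
    refine ⟨?_, fun hw => h2 w hw hp hr.le⟩
    rintro rfl
    exact lt_irrefl _ hr
  classical
  ext y a
  set p := P.pathOf v with hpdef
  have hinr : ∀ t, Function.update y (Sum.inl p) t ∘ Sum.inr = y ∘ Sum.inr := by
    intro t; funext d; simp
  have hinl : ∀ t, Function.update y (Sum.inl p) t ∘ Sum.inl =
      Function.update (y ∘ Sum.inl) p t := by
    intro t; exact Function.update_comp_eq_of_injective _ Sum.inl_injective _ _
  rw [gateOn_mul_apply]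
  simp only [amplitude, hinr, hinl]
  set z : {p // p ∈ P.paths} → Fin 2 := y ∘ Sum.inl with hz
  have hyz : y (Sum.inl p) = z p := rfl
  rw [hyz]
  simp only [mul_left_comm _ P.inputNorm]
  rw [← Finset.mul_sum]
  congr 1
  simp only [← Finset.sum_filter]
  -- The value `t` of the freed bit `x v` is the old bit of the wire, the column index of `J`.
  rw [← Finset.sum_fiberwise _ (fun x : V → Fin 2 => x v)]
  refine Finset.sum_congr rfl fun t _ => ?_
  rw [Finset.mul_sum, Finset.filter_filter]
  refine Finset.sum_bij' (fun x _ => P.overrideAfter v (z p) x)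
    (fun x _ => P.overrideAfter v t x) ?_ ?_ ?_ ?_ ?_
  · intro x hx
    obtain ⟨ha, hx⟩ := (Finset.mem_filter.1 hx).2
    refine Finset.mem_filter.2 ⟨Finset.mem_univ _, ⟨?_, ?_⟩, ?_⟩
    · rw [overrideAfter_input, ha]
    · intro w hw
      rw [hinsert] at hw
      by_cases hp : P.pathOf w = p
      · rw [overrideAfter_of_lt _ _ hp ((hcase w hp hw.2).resolve_left hw.1), hp]
      · rw [overrideAfter_of_le _ _ fun h => absurd h hp, hx w hw.2, Function.update_of_ne hp]
    · rw [overrideAfter_of_le _ _ fun _ => le_rfl, hx v fun _ => hnot, Function.update_self]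
  · intro x hx
    obtain ⟨⟨ha, hx⟩, hxv⟩ := (Finset.mem_filter.1 hx).2
    refine Finset.mem_filter.2 ⟨Finset.mem_univ _, ?_, ?_⟩
    · rw [overrideAfter_input, ha]
    · intro w hw
      by_cases hp : P.pathOf w = p
      · rw [hp, Function.update_self]
        rcases hcase w hp hw with rfl | hr
        · rw [overrideAfter_of_le _ _ fun _ => le_rfl, hxv]
        · rw [overrideAfter_of_lt _ _ hp hr]
      · rw [overrideAfter_of_le _ _ fun h => absurd h hp, Function.update_of_ne hp,
          hx w ((hinsert w).2 ⟨fun h => hp (by rw [h]), hw⟩)]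
  · intro x hx
    obtain ⟨ha, hx⟩ := (Finset.mem_filter.1 hx).2
    refine overrideAfter_overrideAfter fun w hp hr => ?_
    rw [hx w (hafter w hp hr).2, hp, Function.update_self]
  · intro x hx
    obtain ⟨⟨ha, hx⟩, hxv⟩ := (Finset.mem_filter.1 hx).2
    refine overrideAfter_overrideAfter fun w hp hr => ?_
    rw [hx w ((hinsert w).2 (hafter w hp hr)), hp]
  · intro x hx
    obtain ⟨ha, hx⟩ := (Finset.mem_filter.1 hx).2
    rw [Finset.prod_insert hnot]
    congr 1
    · have hxv : x v = t := by rw [hx v fun _ => hnot, Function.update_self]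
      simp only [Gate.weight]
      rw [overrideAfter_of_lt _ _ (P.pathOf_succ hv) (by rw [P.rank_succ hv]; omega),
        overrideAfter_of_le _ _ fun _ => le_rfl, hxv]
    · refine Finset.prod_congr rfl fun b hb => ?_
      cases b with
      | j u hu =>
        have hu' : P.pathOf u = p → P.rank u < P.rank v := fun hp => by
          by_contra! h
          exact h2 u hu hp h hb
        simp only [Gate.weight]
        rw [overrideAfter_of_le _ _ fun hp => (hu' hp).le, overrideAfter_of_le]
        intro hp
        rw [P.rank_succ hu]
        rw [P.pathOf_succ hu] at hp
        exact hu' hp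
      | link d =>
        simp only [Gate.weight]
        rw [overrideAfter_of_le _ _ (h3 d hb)]
      | mid t ht => rfl

/-- Applying a gate to the path sum. -/
theorem op_mul_amplitude (α : V → ℝ) (S : Finset P.Gate) (b : P.Gate) (hb : b ∉ S)
    (hS : PastClosed S) (hS' : PastClosed (insert b S)) :
    b.op α * amplitude α S = amplitude α (insert b S) := by
  cases b with
  | j v hv => exact jGate_mul_amplitude α S v hv hb hS hS'
  | link d =>
    refine diagonal_mul_amplitude α S _ hb (fun v hv h => by cases h) _ fun x y hx => ?_
    -- The link precedes `J` at `d.fst`, so the wire has not yet left this position.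
    have hd : x d.fst = y (Sum.inl (P.pathOf d.fst)) :=
      hx d.fst fun hv hmem => hb (hS (.link d) (.j d.fst hv) rfl hmem)
    rw [czPhase_mk]
    simp only [Gate.weight, hd, Function.comp_apply]
  | mid t ht =>
    exact diagonal_mul_amplitude α S _ hb (fun v hv h => by cases h) _ fun x y _ =>
      czPhase_map_inr t y

theorem prod_op_mul_prepare (α : V → ℝ) (L : List P.Gate) (hL : L.Nodup)
    (hclosed : ∀ L', L' <+: L → PastClosed L'.toFinset) :
    (L.map (Gate.op α)).reverse.prod *
        prepare (W := P.Qubit) (fun i : I => (Sum.inl (P.pathOf i) : P.Qubit)) (fun _ => ketPlus) =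
      amplitude α L.toFinset := by
  induction L using List.reverseRecOn with
  | nil => simp [amplitude_empty]
  | append_singleton L b ih =>
    have hb : b ∉ L := fun h => (List.nodup_append.1 hL).2.2 b h b (by simp) rfl
    have hins : (L ++ [b]).toFinset = insert b L.toFinset := by
      ext; simp
    rw [List.map_append, List.reverse_append, List.prod_append, hins,
      ← op_mul_amplitude α L.toFinset b (by simpa using hb) (hclosed L (List.prefix_append _ _))
        (hins ▸ hclosed _ List.prefix_rfl),
      ← ih (List.nodup_append.1 hL).1 fun L' h => hclosed L' (h.trans (List.prefix_append _ _)),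
      Matrix.mul_assoc]
    simp

theorem IsGateSequence.pastClosed {L : List P.Gate} (hL : P.IsGateSequence L) (L' : List P.Gate)
    (h : L' <+: L) : PastClosed L'.toFinset := by
  obtain ⟨R, rfl⟩ := h
  intro a b hab hb
  rw [List.mem_toFinset] at hb ⊢
  refine (List.mem_append.1 (hL.complete a)).resolve_right fun ha => ?_
  exact (List.pairwise_append.1 hL.order).2.2 b hb a ha hab

/-- For every gate sequence the set of applied gates ends as `Finset.univ`, so the order of `L`
disappears. -/
theorem circuitMap_apply (α : V → ℝ) {L : List P.Gate} (hL : P.IsGateSequence L)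
    (b : O → Fin 2) (a : I → Fin 2) :
    P.circuitMap α L b a = ∑ y,
      star (prepare (W := P.Qubit) (fun o : O => (Sum.inl (P.pathOf o) : P.Qubit))
        (fun _ => ketPlus) y b) * amplitude α Finset.univ y a := by
  have h : L.toFinset = Finset.univ := by
    ext b; simp [hL.complete b]
  unfold circuitMap
  rw [Matrix.mul_assoc, prod_op_mul_prepare α L hL.nodup hL.pastClosed, h, mul_apply]
  rfl

end PathCover

/-! ### Summing out the ancillas -/

section Ancillas

theorem exists_dart_of_edge {V : Type*} (H : SimpleGraph V) (e : H.edgeSet) : ∃ d : H.Dart, d.edge = e := by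
  obtain ⟨⟨u, v⟩, h⟩ := e
  exact ⟨⟨(u, v), h⟩, rfl⟩

variable {V : Type*} [Fintype V] [DecidableEq V] (H : SimpleGraph V) [DecidableRel H.Adj]

/-- An orientation of an edge. -/
def dartOfEdge (e : H.edgeSet) : H.Dart := (exists_dart_of_edge H e).choose

theorem dartOfEdge_edge (e : H.edgeSet) : (dartOfEdge H e).edge = e :=
  (exists_dart_of_edge H e).choose_spec

theorem dartOfEdge_injective : Function.Injective (dartOfEdge H) := fun e e' h =>
  Subtype.ext (by rw [← dartOfEdge_edge, h, dartOfEdge_edge])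

theorem dartOfEdge_edge_eq_or (d : H.Dart) :
    dartOfEdge H ⟨d.edge, d.edge_mem⟩ = d ∨ dartOfEdge H ⟨d.edge, d.edge_mem⟩ = d.symm :=
  (SimpleGraph.dart_edge_eq_iff _ _).1 (dartOfEdge_edge H ⟨d.edge, d.edge_mem⟩)

/-- Every edge gives two darts. -/
def dartEquiv : H.edgeSet ⊕ H.edgeSet ≃ H.Dart :=
  Equiv.ofBijective (Sum.elim (dartOfEdge H) fun e => (dartOfEdge H e).symm) <| by
    have key : ∀ e e', dartOfEdge H e ≠ (dartOfEdge H e').symm := by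
      intro e e' h
      have he : e = e' := Subtype.ext (by
        rw [← dartOfEdge_edge H e, h, SimpleGraph.Dart.edge_symm, dartOfEdge_edge])
      subst he
      exact (dartOfEdge H e).symm_ne h.symm
    constructor
    · rintro (e | e) (e' | e') h
      · exact congrArg _ (dartOfEdge_injective H h)
      · exact absurd h (key e e')
      · exact absurd h.symm (key e' e)
      · exact congrArg _ (dartOfEdge_injective H (SimpleGraph.Dart.symm_involutive.injective h))
    · intro d
      rcases dartOfEdge_edge_eq_or H d with h | h
      · exact ⟨.inl ⟨d.edge, d.edge_mem⟩, h⟩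
      · exact ⟨.inr ⟨d.edge, d.edge_mem⟩, by simp [h]⟩

/-- Pairs of opposite darts are edges. -/
def dartPairEquiv : H.edgeSet ≃ {t : Sym2 H.Dart // ∃ d, t = s(d, d.symm)} :=
  Equiv.ofBijective (fun e => ⟨s(dartOfEdge H e, (dartOfEdge H e).symm), _, rfl⟩) <| by
    constructor
    · intro e e' h
      have h' := congrArg (Sym2.map SimpleGraph.Dart.edge) (Subtype.ext_iff.1 h)
      simp only [Sym2.map_mk, SimpleGraph.Dart.edge_symm, dartOfEdge_edge] at h'
      simpa [Subtype.ext_iff] using h'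
    · rintro ⟨t, d, rfl⟩
      refine ⟨⟨d.edge, d.edge_mem⟩, Subtype.ext ?_⟩
      rcases dartOfEdge_edge_eq_or H d with h | h
      · simp only [h]
      · simp only [h, SimpleGraph.Dart.symm_symm]
        exact Sym2.eq_swap

/-- Summing over the ancillas turns every acausal gate into a `CZ` gate, up to a factor. -/
theorem sum_ancillas (x : V → Fin 2) [Fintype {t : Sym2 H.Dart // ∃ d, t = s(d, d.symm)}] :
    ∑ q : H.Dart → Fin 2, (∏ d, czSign (x d.fst) (q d)) *
      ∏ t : {t : Sym2 H.Dart // ∃ d, t = s(d, d.symm)}, czPhase t.1 q =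
      2 ^ Fintype.card H.edgeSet * ∏ e : H.edgeSet, czPhase e.1 x := by
  have h1 : ∀ q : H.Dart → Fin 2, (∏ d, czSign (x d.fst) (q d)) *
      ∏ t : {t : Sym2 H.Dart // ∃ d, t = s(d, d.symm)}, czPhase t.1 q =
      ∏ e : H.edgeSet, czSign (x (dartOfEdge H e).fst) (q (dartOfEdge H e)) *
        czSign (x (dartOfEdge H e).snd) (q (dartOfEdge H e).symm) *
        czSign (q (dartOfEdge H e)) (q (dartOfEdge H e).symm) := by
    intro q
    rw [← Equiv.prod_comp (dartEquiv H), ← Equiv.prod_comp (dartPairEquiv H),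
      Fintype.prod_sum_type, ← Finset.prod_mul_distrib, ← Finset.prod_mul_distrib]
    refine Finset.prod_congr rfl fun e _ => ?_
    congr 1
    exact czPhase_mk _ _ q
  simp only [h1]
  -- Regroup the ancilla bits into one pair per edge, so that the sum factors over edges.
  let E : (H.edgeSet → Fin 2 × Fin 2) ≃ (H.Dart → Fin 2) :=
    (Equiv.arrowProdEquivProdArrow _ _ _).trans
      ((Equiv.sumArrowEquivProdArrow _ _ _).symm.trans ((dartEquiv H).arrowCongr (Equiv.refl _)))
  have hE1 : ∀ r e, E r (dartOfEdge H e) = (r e).1 := by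
    intro r e
    have : (dartEquiv H).symm (dartOfEdge H e) = .inl e :=
      (Equiv.symm_apply_eq _).2 rfl
    simp [E, this]
  have hE2 : ∀ r e, E r (dartOfEdge H e).symm = (r e).2 := by
    intro r e
    have : (dartEquiv H).symm (dartOfEdge H e).symm = .inr e :=
      (Equiv.symm_apply_eq _).2 rfl
    simp [E, this]
  rw [← Equiv.sum_comp E]
  simp only [hE1, hE2]
  have h2 := Finset.prod_univ_sum (fun _ : H.edgeSet => (Finset.univ : Finset (Fin 2 × Fin 2)))
    (fun e r => czSign (x (dartOfEdge H e).fst) r.1 * czSign (x (dartOfEdge H e).snd) r.2 *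
      czSign r.1 r.2)
  rw [Fintype.piFinset_univ] at h2
  rw [← h2]
  simp only [sum_czSign_mul]
  rw [Finset.prod_mul_distrib, Finset.prod_const, Finset.card_univ]
  congr 1
  refine Finset.prod_congr rfl fun e _ => ?_
  rw [← czPhase_mk, ← dartOfEdge_edge H e]
  rfl

end Ancillas

/-- A `J` gate is a measurement bra on the old bit after CZ with the new bit; the CZ is the path
edge. -/
theorem jMatrix_apply (α : ℝ) (p q : Fin 2) :
    jMatrix α p q = star (ketXY α 0 q) * czSign q p := by
  have e0 : ketXY α 0 0 = 1 / (Real.sqrt 2 : ℂ) := rfl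
  have e1 : ketXY α 0 1 =
    (-1) ^ ((0 : Fin 2) : ℕ) * Complex.exp (Complex.I * (α : ℂ)) / (Real.sqrt 2 : ℂ) := rfl
  have hc : (starRingEnd ℂ) (Complex.exp (Complex.I * α)) =
      Complex.exp (-(Complex.I * α)) := by
    rw [← Complex.exp_conj]; simp
  fin_cases q
  · fin_cases p <;> simp [jMatrix, e0, czSign]
  · fin_cases p <;> simp [jMatrix, e1, czSign, hc, div_eq_inv_mul]

theorem exists_pos_prod_ketPlus {W : Type*} (S : Finset W) :
    ∃ r : ℝ, 0 < r ∧ ∏ _w ∈ S, ketPlus 0 = (r : ℂ) := by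
  refine ⟨(1 / Real.sqrt 2) ^ S.card, by positivity, ?_⟩
  rw [Finset.prod_const, ketPlus]
  push_cast
  rfl

/-! ### Comparison of circuit and pattern -/

namespace PathCover

variable {V : Type*} [Fintype V] [DecidableEq V] {G : SimpleGraph V} {I O : Finset V}
  {P : PathCover G I O}

theorem prod_weight (α : V → ℝ) (x : V → Fin 2) (q : P.offGraph.Dart → Fin 2)
    [Fintype {t : Sym2 P.offGraph.Dart // ∃ d, t = s(d, d.symm)}] :
    ∏ b : P.Gate, b.weight α x q =
      (∏ v : {v // v ∉ O}, jMatrix (α v) (x (P.succ v)) (x v)) *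
        ((∏ d : P.offGraph.Dart, czSign (x d.fst) (q d)) *
          ∏ t : {t : Sym2 P.offGraph.Dart // ∃ d, t = s(d, d.symm)}, czPhase t.1 q) := by
  rw [← Equiv.prod_comp P.gateEquiv.symm, Fintype.prod_sum_type, Fintype.prod_sum_type]
  rfl

/-- The edges of the graph are the steps of the paths and the remaining edges. -/
theorem entanglerPhase_eq [DecidableRel G.Adj] (P : PathCover G I O) (x : V → Fin 2) :
    entanglerPhase G x = (∏ v : {v // v ∉ O}, czSign (x v) (x (P.succ v))) *
      ∏ e : P.offGraph.edgeSet, czPhase e.1 x := by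
  classical
  unfold entanglerPhase
  rw [← Finset.prod_filter_mul_prod_filter_not _ (fun e => e ∈ P.offGraph.edgeSet), mul_comm]
  congr 1
  · symm
    refine Finset.prod_bij (fun v _ => s(v.1, P.succ v.1)) ?_ ?_ ?_ ?_
    · intro v _
      have hs := P.step_succ v.2
      simp only [Finset.mem_filter, SimpleGraph.mem_edgeFinset, SimpleGraph.mem_edgeSet]
      exact ⟨hs.adj, fun h => h.2.1 hs⟩
    · intro u _ v _ h
      rcases Sym2.eq_iff.1 h with ⟨h1, -⟩ | ⟨h1, h2⟩
      · exact Subtype.ext h1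
      -- One edge cannot be a step in both directions, since `rank` increases along each step.
      · have h3 := P.rank_succ u.2
        have h4 := P.rank_succ v.2
        rw [h2] at h3
        rw [← h1] at h4
        omega
    · intro e he
      obtain ⟨u, v⟩ := e
      have he' := Finset.mem_filter.1 he
      have hadj : G.Adj u v := by simpa using he'.1
      have hoff : ¬ (G.Adj u v ∧ ¬ P.Step u v ∧ ¬ P.Step v u) := he'.2
      by_cases huv : P.Step u v
      · exact ⟨⟨u, huv.not_mem_output⟩, Finset.mem_univ _, by rw [P.succ_eq huv]⟩
      · have hvu : P.Step v u := by tauto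
        exact ⟨⟨v, hvu.not_mem_output⟩, Finset.mem_univ _, by
          rw [P.succ_eq hvu]; exact Sym2.eq_swap⟩
    · intro v _
      rw [czPhase_mk]
  · refine Finset.prod_subtype _ (fun e => ?_) _
    simp only [Finset.mem_filter, SimpleGraph.mem_edgeFinset, and_iff_right_iff_imp]
    obtain ⟨u, v⟩ := e
    exact fun h => h.1

theorem sum_weight [DecidableRel G.Adj] (α : V → ℝ) (x : V → Fin 2) :
    ∑ q : P.offGraph.Dart → Fin 2, ∏ b : P.Gate, b.weight α x q =
      2 ^ Fintype.card P.offGraph.edgeSet *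
        ((∏ v with v ∉ O, star (ketXY (α v) 0 (x v))) * entanglerPhase G x) := by
  classical
  simp only [prod_weight]
  rw [← Finset.mul_sum, sum_ancillas, entanglerPhase_eq P]
  simp only [jMatrix_apply]
  rw [Finset.prod_mul_distrib,
    Finset.prod_subtype (p := fun v => v ∉ O) ({v | v ∉ O} : Finset V) (by simp)
      (fun v => star (ketXY (α v) 0 (x v)))]
  ring

/-- The circuit as a path sum over the bits at all positions. -/
theorem exists_circuitMap_apply [DecidableRel G.Adj] (P : PathCover G I O) (α : V → ℝ) :
    ∃ r : ℝ, 0 < r ∧ ∀ L : List P.Gate, P.IsGateSequence L → ∀ b a,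
      P.circuitMap α L b a = r * ∑ x : V → Fin 2,
        if (fun v : O => x v) = b ∧ (fun i : I => x i) = a then
          (∏ v with v ∉ O, star (ketXY (α v) 0 (x v))) * entanglerPhase G x else 0 := by
  classical
  obtain ⟨r₁, hr₁, h₁⟩ := exists_pos_prod_ketPlus
    {w : P.Qubit | w ∉ Set.range (fun i : I => (Sum.inl (P.pathOf i) : P.Qubit))}
  obtain ⟨r₂, hr₂, h₂⟩ := exists_pos_prod_ketPlus
    {w : P.Qubit | w ∉ Set.range (fun o : O => (Sum.inl (P.pathOf o) : P.Qubit))}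
  -- The factors are the `⟨+|` post-selections, the `|+⟩` preparations, and a `2` from each acausal
  -- gate.
  refine ⟨r₂ * r₁ * 2 ^ Fintype.card P.offGraph.edgeSet, by positivity, fun L hL b a => ?_⟩
  rw [circuitMap_apply α hL]
  have hprep : ∀ y : P.Qubit → Fin 2,
      star (prepare (W := P.Qubit) (fun o : O => (Sum.inl (P.pathOf o) : P.Qubit))
        (fun _ => ketPlus) y b) =
      if (fun o : O => y (Sum.inl (P.pathOf o))) = b then (r₂ : ℂ) else 0 := by
    intro y
    rw [prepare_apply]
    simp only [Function.comp_def]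
    split_ifs
    · have : ∀ t, ketPlus t = ketPlus 0 := fun _ => rfl
      simp only [this]
      rw [← Complex.conj_ofReal, ← h₂]
      congr!
    · simp
  have hnorm : P.inputNorm = r₁ := by
    rw [← h₁]; unfold inputNorm; congr!
  simp only [hprep, amplitude, hnorm]
  rw [← Equiv.sum_comp (Equiv.sumArrowEquivProdArrow {p // p ∈ P.paths} P.offGraph.Dart
    (Fin 2)).symm, Fintype.sum_prod_type]
  let e : O ≃ {p // p ∈ P.paths} := Equiv.ofBijective _ P.pathOf_output_bijective
  rw [← Equiv.sum_comp (e.arrowCongr (Equiv.refl (Fin 2)))]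
  have he : ∀ (c : O → Fin 2) (o : O), (e.arrowCongr (Equiv.refl (Fin 2))) c (P.pathOf o) = c o := by
    intro c o
    have : e.symm (P.pathOf o) = o := (Equiv.symm_apply_eq _).2 rfl
    simp [this]
  have hl : ∀ (y₁ : {p // p ∈ P.paths} → Fin 2) (y₂ : P.offGraph.Dart → Fin 2),
      (Equiv.sumArrowEquivProdArrow {p // p ∈ P.paths} P.offGraph.Dart (Fin 2)).symm (y₁, y₂) ∘
        Sum.inl = y₁ := fun _ _ => rfl
  have hr : ∀ (y₁ : {p // p ∈ P.paths} → Fin 2) (y₂ : P.offGraph.Dart → Fin 2),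
      (Equiv.sumArrowEquivProdArrow {p // p ∈ P.paths} P.offGraph.Dart (Fin 2)).symm (y₁, y₂) ∘
        Sum.inr = y₂ := fun _ _ => rfl
  have hl' : ∀ (y₁ : {p // p ∈ P.paths} → Fin 2) (y₂ : P.offGraph.Dart → Fin 2) p,
      (Equiv.sumArrowEquivProdArrow {p // p ∈ P.paths} P.offGraph.Dart (Fin 2)).symm (y₁, y₂)
        (Sum.inl p) = y₁ p := fun _ _ _ => rfl
  -- After all gates only the output positions are still tied to the wires.
  have hcons : ∀ (c : O → Fin 2) (x : V → Fin 2),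
      Consistent (Finset.univ : Finset P.Gate) x ((e.arrowCongr (Equiv.refl (Fin 2))) c) ↔
        (fun v : O => x v) = c := by
    intro c x
    constructor
    · intro h
      funext o
      rw [h o fun hv => absurd o.2 hv, he]
    · rintro rfl v hv
      have hvO : v ∈ O := by
        by_contra h
        exact hv h (Finset.mem_univ _)
      exact (he (fun v : O => x v) ⟨v, hvO⟩).symm
  simp only [hl, hr, hl', he, hcons]
  rw [Finset.sum_eq_single b]
  · simp only [if_true]
    rw [← Finset.mul_sum, ← Finset.mul_sum, Finset.sum_comm, Finset.mul_sum, Finset.mul_sum,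
      Finset.mul_sum]
    refine Finset.sum_congr rfl fun x _ => ?_
    by_cases hx : (fun v : O => x v) = b ∧ (fun i : I => x i) = a
    · simp only [hx, and_self, if_true]
      rw [sum_weight]
      push_cast
      ring
    · have hx' : ¬ ((fun i : I => x i) = a ∧ (fun v : O => x v) = b) := fun h => hx h.symm
      simp only [hx, hx', if_false, Finset.sum_const_zero, mul_zero]
  · intro c _ hc
    simp [hc]
  · simp

/-- The circuit implements a positive multiple of the map of the pattern. -/
theorem exists_circuitMap_eq_smul [DecidableRel G.Adj] (P : PathCover G I O) (α : V → ℝ) :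
    ∃ r : ℝ, 0 < r ∧ ∀ L : List P.Gate, P.IsGateSequence L →
      P.circuitMap α L = (r : ℂ) • patternMap G I O α := by
  obtain ⟨r, hr, h⟩ := exists_circuitMap_apply P α
  obtain ⟨r', hr', h'⟩ := exists_pos_prod_ketPlus ({w | w ∉ I} : Finset V)
  -- `r'` is the `|+⟩` normalization already contained in `patternMap`.
  refine ⟨r / r', div_pos hr hr', fun L hL => ?_⟩
  ext b a
  rw [h L hL, Matrix.smul_apply, patternMap_apply, smul_eq_mul, Finset.mul_sum, Finset.mul_sum]
  refine Finset.sum_congr rfl fun x _ => ?_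
  have hI : prepare (fun i : I => (i : V)) (fun _ => ketPlus) x a =
      if (fun i : I => x i) = a then (r' : ℂ) else 0 := by
    rw [prepare_coe_apply, ← h']
    rfl
  have hne : (r' : ℂ) ≠ 0 := by exact_mod_cast hr'.ne'
  rw [hI]
  by_cases h1 : (fun v : O => x v) = b
  · by_cases h2 : (fun i : I => x i) = a
    · simp only [h1, h2, and_self, if_true]
      push_cast
      field_simp
    · simp [h1, h2]
  · simp [h1]

end PathCover

end MBQC

end

/-! ### Normalization to an isometry -/

theorem mainTheorem6 {V : Type*} [Fintype V] [DecidableEq V]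
    (G : SimpleGraph V) [DecidableRel G.Adj] (I O : Finset V)
    (g : V → Finset V) (prec : V → V → Prop) (hg : MBQC.IsGFlow G I O g prec)
    (P : MBQC.PathCover G I O) (α : V → ℝ) :
    ∃ U : Matrix (O → Fin 2) (I → Fin 2) ℂ,
      U.conjTranspose * U = 1 ∧
      (I.card = O.card → U * U.conjTranspose = 1) ∧
      (∃ r : ℝ, 0 < r ∧ MBQC.patternMap G I O α = (r : ℂ) • U) ∧
      (∀ s : V → Fin 2, ∃ c : ℂ, c ≠ 0 ∧ MBQC.patternBranch G I O g α s = c • U) ∧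
      (∃ L : List P.Gate, P.IsGateSequence L) ∧
      (∃ r : ℝ, 0 < r ∧ ∀ L : List P.Gate, P.IsGateSequence L →
        P.circuitMap α L = (r : ℂ) • U) := by
  obtain ⟨R, hR, hgram⟩ := MBQC.exists_smul_patternMap_gram G hg α
  have hsqrt : 0 < Real.sqrt R := Real.sqrt_pos.2 hR
  have hsqrt0 : (Real.sqrt R : ℂ) ≠ 0 := by exact_mod_cast hsqrt.ne'
  set U : Matrix (O → Fin 2) (I → Fin 2) ℂ := (Real.sqrt R : ℂ) • MBQC.patternMap G I O α with hU
  have hU' : MBQC.patternMap G I O α = (((Real.sqrt R)⁻¹ : ℝ) : ℂ) • U := by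
    rw [hU, smul_smul, Complex.ofReal_inv, inv_mul_cancel₀ hsqrt0, one_smul]
  have hUU : U.conjTranspose * U = 1 := by
    rw [hU, Matrix.conjTranspose_smul, Matrix.smul_mul, Matrix.mul_smul, smul_smul,
      RCLike.star_def, Complex.conj_ofReal, ← Complex.ofReal_mul, Real.mul_self_sqrt hR.le, hgram]
  refine ⟨U, hUU, fun hcard => ?_, ⟨_, inv_pos.2 hsqrt, hU'⟩, fun s => ?_,
    P.exists_isGateSequence, ?_⟩
  · exact (Matrix.mul_eq_one_comm_of_card_eq _ _ _ (by simp [hcard])).1 hUU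
  · obtain ⟨c, hc, h⟩ := MBQC.exists_patternBranch_eq_smul G hg α s
    refine ⟨c * (((Real.sqrt R)⁻¹ : ℝ) : ℂ), mul_ne_zero hc ?_, ?_⟩
    · exact_mod_cast (inv_pos.2 hsqrt).ne'
    · rw [h, hU', smul_smul]
  · obtain ⟨r, hr, h⟩ := MBQC.PathCover.exists_circuitMap_eq_smul P α
    refine ⟨r * (Real.sqrt R)⁻¹, mul_pos hr (inv_pos.2 hsqrt), fun L hL => ?_⟩
    rw [h L hL, hU', smul_smul, Complex.ofReal_mul]
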